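/- Let $h>0$, $n\ge 0$, $k\ge 1$, let $X=C([-h,0],\mathbb R^n)$ with the supremum norm, let $F\in C^{k+1}(X,\mathbb R^n)$, and let $\gamma:\mathbb R\to\mathbb R^n$ be a $T$-periodic solution ($T>0$) of $\dot x(t)=F(x_t)$, where $x_t(\theta)=x(t+\theta)$. Put $L(t)=DF(\gamma_t)\in\mathcal L(X,\mathbb R^n)$ and let $U(t,s)\in\mathcal L(X)$, $t\ge s$, be the solution operators of $\dot y(t)=L(t)y_t$, i.e. $U(t,s)y_s=y_t$. For $\tau\in\mathbb R$ let $A(\tau)\varphi=\dot\varphi$ on $\mathcal D(A(\tau))=\{\varphi\in C^1([-h,0],\mathbb R^n):\dot\varphi(0)=L(\tau)\varphi\}$. Let $X^{\odot\star}=\mathbb R^n\times L^\infty([-h,0],\mathbb R^n)$, $j:X\to X^{\odot\star}$, $j\varphi=(\varphi(0),\varphi)$, and $A^{\odot\star}(\tau)j\varphi=(L(\tau)\varphi,\dot\varphi)$ on $\mathcal D(A^{\odot\star}(\tau))=\{j\varphi:\varphi\ \text{Lipschitz}\}$. A Floquet multiplier is a nonzero element of the spectrum of the (complexified) monodromy operator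 $U(s+T,s)$. For a real Floquet multiplier $\lambda$, $E_\lambda(\tau)\subseteq X$ denotes the generalized eigenspace of $U(\tau+T,\tau)$ at $\lambda$, and $m=m_\lambda=\dim E_\lambda(s)$. Let $s\in\mathbb R$, let $\lambda<0$ be a real Floquet multiplier (of $U(s+T,s)$), and let $\sigma\in\mathbb R$ be defined by $e^{\sigma T}=|\lambda|$. Then: 1. There are $\delta_1,\dots,\delta_{m-1}\in\{0,1\}$, all equal to $1$ if the geometric multiplicity $\dim\ker(U(s+T,s)-\lambda I)$ is one, and maps $\varphi_0,\dots,\varphi_{m-1}\in C^{k+1}(\mathbb R,X)$ that are $2T$-periodic and $T$-antiperiodic, $\varphi_i(\tau+T)=-\varphi_i(\tau)$, such that for every $\tau\in\mathbb R$ the family $(\varphi_0(\tau),\dots,\varphi_{m-1}(\tau))$ is an ordered basis of $E_\lambda(\tau)$, with $\varphi_i(\tau)\in\mathcal D(A(\tau))$, and $$\Big(\frac{d}{d\tau}-A^{\odot\star}(\tau)+\sigma\Big)j\varphi_i(\tau)=\begin{cases}0,& i=0,\\ -\delta_i\, j\varphi_{i-1}(\tau),& 1\le i\le m-1,\end{cases}$$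 $$\Big(\frac{d}{d\tau}-A(\tau)+\sigma\Big)\varphi_i(\tau)=\begin{cases}0,& i=0,\\ -\delta_i\,\varphi_{i-1}(\tau),& 1\le i\le m-1.\end{cases}$$ 2. For these maps, the Floquet operator $Q_\lambda(\tau):\mathbb R^{m}\to E_\lambda(\tau)$, $Q_\lambda(\tau)\xi=\sum_{i=0}^{m-1}\xi_i\varphi_i(\tau)$, satisfies $Q_\lambda(\tau+T)=-Q_\lambda(\tau)$ and $$\Big(-\frac{d}{d\tau}+A^{\odot\star}(\tau)\Big)j(Q_\lambda(\tau)\xi)=j(Q_\lambda(\tau)M_\lambda\xi),\qquad \xi\in\mathbb R^m,\ \tau\in\mathbb R,$$ where $M_\lambda$ is the real $m\times m$ Jordan matrix with diagonal entries $\sigma$, superdiagonal entries $\delta_1,\dots,\delta_{m-1}$, and all other entries $0$. 3. There are bounded linear projections $P_\lambda(\tau)\in\mathcal L(X)$, $\tau\in\mathbb R$, of the real space $X$ with range $E_\lambda(\tau)$, commuting with $U(\tau+T,\tau)$, and such that $P_\lambda(\tau+T)=P_\lambda(\tau)$. -/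

import Mathlib

open MeasureTheory
open scoped TensorProduct

noncomputable section

namespace PeriodicDDE

/-- `ℝⁿ`. -/
abbrev Vec (n : ℕ) : Type := EuclideanSpace ℝ (Fin n)

/-- The state space `X = C([-h,0], ℝⁿ)` with the supremum norm. -/
abbrev State (h : ℝ) (n : ℕ) : Type := C(Set.Icc (-h) (0 : ℝ), Vec n)

/-- A state seen as a function on the line, with the value `0` outside `[-h,0]`. It is only
used through its restriction to `[-h,0]`. -/
def onLine {h : ℝ} {n : ℕ} (φ : State h n) : ℝ → Vec n :=
  Function.extend Subtype.val φ 0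

/-- The history `x_t(θ) = x(t + θ)`, `θ ∈ [-h,0]`. -/
def hist (h : ℝ) {n : ℕ} (x : C(ℝ, Vec n)) (t : ℝ) : State h n where
  toFun θ := x (t + (θ : ℝ))
  continuous_toFun := by fun_prop

/-- `γ` is a `T`-periodic solution of `x'(t) = F(x_t)`. -/
structure IsPeriodicSolution {h : ℝ} {n : ℕ} (F : State h n → Vec n) (γ : C(ℝ, Vec n))
    (T : ℝ) : Prop where
  period_pos : 0 < T
  periodic : Function.Periodic γ T
  solves : ∀ t : ℝ, HasDerivAt γ (F (hist h γ t)) t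

/-- `L(t) = DF(γ_t)`. -/
def linearization {h : ℝ} {n : ℕ} (F : State h n → Vec n) (γ : C(ℝ, Vec n)) (t : ℝ) :
    State h n →L[ℝ] Vec n :=
  fderiv ℝ F (hist h γ t)

/-- `y` solves `y'(t) = L(t) y_t` for `t ≥ s`, with `y_s = φ` (the derivative at `t = s` is the
one from the right; values of `y` before `s - h` play no role). -/
def IsLinearSolution {h : ℝ} {n : ℕ} (L : ℝ → State h n →L[ℝ] Vec n) (s : ℝ) (φ : State h n)
    (y : C(ℝ, Vec n)) : Prop :=
  hist h y s = φ ∧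
    ∀ t : ℝ, s ≤ t → HasDerivWithinAt y (L t (hist h y t)) (Set.Ici s) t

/-- `A` is the solution operator from time `s` to time `t`: for each initial state `φ` at time
`s`, the state at time `t` of the solution through `φ` is `A φ`. -/
def IsSolutionOperator {h : ℝ} {n : ℕ} (L : ℝ → State h n →L[ℝ] Vec n) (t s : ℝ)
    (A : State h n →L[ℝ] State h n) : Prop :=
  ∀ φ : State h n, ∃ y : C(ℝ, Vec n), IsLinearSolution L s φ y ∧ hist h y t = A φ

open Classical in
/-- The evolutionary system `U(t,s)`, `t ≥ s`, of `y'(t) = L(t) y_t`: the solution operator from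
time `s` to time `t`. For continuous `L` and `t ≥ s` it exists and is unique. -/
def evolution {h : ℝ} {n : ℕ} (L : ℝ → State h n →L[ℝ] Vec n) (t s : ℝ) :
    State h n →L[ℝ] State h n :=
  if hA : ∃ A, IsSolutionOperator L t s A then hA.choose else 0

/-- The monodromy operator `U(s+T,s)`. -/
def monodromy {h : ℝ} {n : ℕ} (L : ℝ → State h n →L[ℝ] Vec n) (T s : ℝ) :
    State h n →L[ℝ] State h n :=
  evolution L (s + T) s

/-- The monodromy operator as an element of the algebra of linear endomorphisms. -/
def monodromyEnd {h : ℝ} {n : ℕ} (L : ℝ → State h n →L[ℝ] Vec n) (T s : ℝ) :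
    Module.End ℝ (State h n) :=
  (monodromy L T s : State h n →ₗ[ℝ] State h n)

/-- Floquet multipliers: the nonzero elements of the spectrum of the complexified monodromy
operator `1 ⊗ U(s+T,s)` on `ℂ ⊗ X`. (A bijective bounded operator on a Banach space has a
bounded inverse, so the spectrum among linear endomorphisms is the spectrum of the bounded
operator.) -/
def IsFloquetMultiplier {h : ℝ} {n : ℕ} (L : ℝ → State h n →L[ℝ] Vec n) (T s : ℝ)
    (μ : ℂ) : Prop :=
  μ ≠ 0 ∧
    μ ∈ spectrum ℂ
      (LinearMap.baseChange ℂ (monodromyEnd L T s) : Module.End ℂ (ℂ ⊗[ℝ] State h n))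

/-- The (generalized) eigenspace `E_λ(s)` of a real Floquet multiplier `λ`, i.e. the union of the
increasing sequence of kernels of `(U(s+T,s) - λ)^k`. -/
def genEigenspace {h : ℝ} {n : ℕ} (L : ℝ → State h n →L[ℝ] Vec n) (T lam s : ℝ) :
    Submodule ℝ (State h n) :=
  (monodromyEnd L T s).maxGenEigenspace lam

/-- The algebraic multiplicity `m_λ = dim E_λ(s)`. -/
def algMult {h : ℝ} {n : ℕ} (L : ℝ → State h n →L[ℝ] Vec n) (T lam s : ℝ) : ℕ :=
  Module.finrank ℝ (genEigenspace L T lam s)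

/-- The geometric multiplicity: the dimension of the kernel of `U(s+T,s) - λ`. -/
def geomMult {h : ℝ} {n : ℕ} (L : ℝ → State h n →L[ℝ] Vec n) (T lam s : ℝ) : ℕ :=
  Module.finrank ℝ ((monodromyEnd L T s).eigenspace lam)

/-- `φ ∈ D(A(τ))` and `A(τ) φ = ψ`, where `D(A(τ)) = {φ ∈ C¹([-h,0], ℝⁿ) : φ'(0) = L(τ) φ}` and
`A(τ) φ = φ'`; here `Lτ` stands for `L(τ)`. -/
def Generator {h : ℝ} {n : ℕ} (Lτ : State h n →L[ℝ] Vec n) (φ ψ : State h n) : Prop :=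
  (∀ θ : Set.Icc (-h) (0 : ℝ),
    HasDerivWithinAt (onLine φ) (ψ θ) (Set.Icc (-h) 0) (θ : ℝ)) ∧
  onLine ψ 0 = Lτ φ

/-- Lebesgue measure on `[-h,0]`. -/
def delayMeasure (h : ℝ) : Measure (Set.Icc (-h) (0 : ℝ)) :=
  Measure.comap Subtype.val volume

instance instIsFiniteMeasureDelay (h : ℝ) : IsFiniteMeasure (delayMeasure h) := by
  refine ⟨?_⟩
  rw [delayMeasure, comap_subtype_coe_apply measurableSet_Icc, Set.image_univ,
    Subtype.range_coe]
  exact measure_Icc_lt_top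

/-- `X^{⊙⋆} = ℝⁿ × L^∞([-h,0], ℝⁿ)`. -/
abbrev SunStar (h : ℝ) (n : ℕ) : Type :=
  Vec n × Lp (Vec n) ⊤ (delayMeasure h)

/-- The canonical embedding `j φ = (φ(0), φ)`. -/
def embed {h : ℝ} {n : ℕ} (φ : State h n) : SunStar h n :=
  (onLine φ 0, ContinuousMap.toLp ⊤ (delayMeasure h) ℝ φ)

/-- `x ∈ D(A^{⊙⋆}(τ))` and `A^{⊙⋆}(τ) x = y`, where
`D(A^{⊙⋆}(τ)) = {(α, φ) : φ Lipschitz, φ(0) = α}` and `A^{⊙⋆}(τ) j φ = (L(τ) φ, φ')`; here `Lτ`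
stands for `L(τ)`, and `φ'` is the (almost everywhere) derivative of `φ`. -/
def SunStarGenerator {h : ℝ} {n : ℕ} (Lτ : State h n →L[ℝ] Vec n) (x y : SunStar h n) : Prop :=
  ∃ φ : State h n, (∃ K : NNReal, LipschitzWith K φ) ∧ x = embed φ ∧ y.1 = Lτ φ ∧
    ∀ᵐ θ ∂(delayMeasure h),
      HasDerivWithinAt (onLine φ) (y.2 θ) (Set.Icc (-h) 0) (θ : ℝ)

/-- The preceding member of a Jordan chain: `δᵢ vᵢ₋₁` for `i ≥ 1`, and `0` for `i = 0`. -/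
def chainPrev {m : ℕ} {V : Type*} [AddCommGroup V] [Module ℝ V] (δ : Fin m → ℝ) (v : Fin m → V)
    (i : Fin m) : V :=
  if (i : ℕ) = 0 then 0 else δ i • v ⟨(i : ℕ) - 1, by omega⟩

/-- The real Jordan matrix with `σ` on the diagonal and `δ₁, …, δ_{m-1}` above it. -/
def jordanMatrix {m : ℕ} (σ : ℝ) (δ : Fin m → ℝ) : Matrix (Fin m) (Fin m) ℝ :=
  Matrix.of fun i j => if i = j then σ else if (i : ℕ) + 1 = (j : ℕ) then δ j else 0

/-- The Floquet operator `Q(τ) ξ = ∑ᵢ ξᵢ φᵢ(τ)`. -/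
def floquetOperator {h : ℝ} {n m : ℕ} (φ : Fin m → ℝ → State h n) (τ : ℝ) :
    (Fin m → ℝ) →ₗ[ℝ] State h n :=
  Fintype.linearCombination ℝ (fun i => φ i τ)

end PeriodicDDE

end

/-!
The state space is infinite-dimensional and the monodromy operator `U(τ+T,τ)` need not be compact,
but its powers `U(τ+NT,τ)` with `NT ≥ h` are, because solutions become Lipschitz after time `h`
(`exists_isCompactOperator_monodromy_pow`). Riesz theory for these powers shows that the generalized
eigenspace `E(τ)` at `lam ≠ 0` is finite-dimensional and is the range of a bounded projection
commuting with `U(τ+T,τ)` (`exists_spectral_projection`). Since the monodromy operator is periodic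
in `τ`, choosing the projection as a function of the operator makes it periodic as well.

Fix `s` and let `M` be the restriction of `U(s+T,s)` to `E = E(s)`. It is invertible, so solutions
starting in `E` extend linearly to solutions `X ξ` on the whole line, with
`(X ξ)_{t+T} = (X (M ξ))_t` (`exists_entire_extension`). The map `ξ ↦ (X ξ)_τ` is an isomorphism from
`E` onto `E(τ)`: it is injective with values in `E(τ)`, and by symmetry the dimensions agree
(`finrank_genEigenspace_le`).

As `lam < 0`, one has `M = -exp (T (σ + B))` with `B` nilpotent. For a Jordan basis `e` of `B`, the
curves `c i t = exp (-t (σ + B)) (e i)` in `E` satisfy `c i' = -(σ c i + δ i c (i-1))` and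
`M (c i (t + T)) = -c i t` (`exists_antiperiodic_jordan_curves`). The Floquet basis is
`φ i t = (X (c i t))_t`. The two relations for `c` are the chain equations and the antiperiodicity of
`φ`: differentiating the solution `X ξ` for fixed `ξ` produces the generator, and differentiating
`c` produces the remaining terms. Smoothness follows from that of `L`, since a solution is one order
smoother than the equation. The sun-star versions are images under the bounded embedding `j`.
-/

/-! ### Jordan bases and antiperiodic curves of a nilpotent perturbation of a scalar -/

namespace PeriodicDDE

/-- A nilpotent endomorphism has a Jordan basis, listed along `ℕ`. If `v` is a vector of maximal
height `k + 1`, the chain `N ^ k v, …, v` has the invariant complement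
`{w | f (N ^ i w) = 0 for i ≤ k}`, where `f` is a functional with `f (N ^ k v) ≠ 0`; the rest of the
basis comes from this complement by induction on the dimension. -/
theorem exists_jordan_sequence (d : ℕ) : ∀ {V : Type*} [AddCommGroup V] [Module ℝ V]
    [FiniteDimensional ℝ V] (N : Module.End ℝ V), IsNilpotent N → Module.finrank ℝ V = d →
    ∃ (δ : ℕ → ℝ) (e : ℕ → V), (∀ i, δ i = 0 ∨ δ i = 1) ∧ (0 < d → N (e 0) = 0) ∧
      (∀ i, i + 1 < d → N (e (i + 1)) = δ (i + 1) • e i) ∧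
      ∀ v : V, ∃ c : ℕ → ℝ, v = ∑ i ∈ Finset.range d, c i • e i := by
  induction d using Nat.strong_induction_on with
  | _ d ih =>
  intro V _ _ _ N hN hd
  rcases Nat.eq_zero_or_pos d with rfl | hdpos
  · have : Subsingleton V := Module.finrank_zero_iff.mp hd
    exact ⟨0, 0, by simp, by simp, by simp, fun v => ⟨0, Subsingleton.elim _ _⟩⟩
  have hnt : Nontrivial V := Module.nontrivial_of_finrank_pos (R := ℝ) (by omega)
  -- `k + 1` is the nilpotency index of `N`
  obtain ⟨k, hk1, hk2⟩ : ∃ k : ℕ, N ^ k ≠ 0 ∧ N ^ (k + 1) = 0 := by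
    have h0 : nilpotencyClass N ≠ 0 := (pos_nilpotencyClass_iff.mpr hN).ne'
    obtain ⟨k, hk⟩ := Nat.exists_eq_succ_of_ne_zero h0
    exact ⟨k, pow_pred_nilpotencyClass hN |> (by simpa [hk] using ·), by
      simpa [hk] using pow_nilpotencyClass hN⟩
  obtain ⟨v, hv⟩ : ∃ v, (N ^ k) v ≠ 0 := by
    by_contra! h
    exact hk1 (LinearMap.ext h)
  obtain ⟨f, hf⟩ : ∃ f : Module.Dual ℝ V, f ((N ^ k) v) ≠ 0 := by
    by_contra! h
    exact hv ((Module.forall_dual_apply_eq_zero_iff ℝ _).mp h)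
  have hbig : ∀ i, k < i → N ^ i = 0 := fun i hi => pow_eq_zero_of_le hi hk2
  let Φ : V →ₗ[ℝ] (Fin (k + 1) → ℝ) := LinearMap.pi fun i => f ∘ₗ (N ^ (i : ℕ))
  let Ψ : (Fin (k + 1) → ℝ) →ₗ[ℝ] V := Fintype.linearCombination ℝ fun i => (N ^ (k - (i : ℕ))) v
  have hΨ : ∀ c, Ψ c = ∑ i : Fin (k + 1), c i • (N ^ (k - (i : ℕ))) v := fun c => by
    simp [Ψ, Fintype.linearCombination_apply]
  -- the pairing of the chain through `v` with the functionals `f ∘ N ^ i` is triangular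
  have hinj : Function.Injective (Φ ∘ₗ Ψ) := by
    rw [← LinearMap.ker_eq_bot, LinearMap.ker_eq_bot']
    intro c hc
    by_contra hne
    obtain ⟨j, hj, hmax⟩ : ∃ j : Fin (k + 1), c j ≠ 0 ∧ ∀ i, j < i → c i = 0 := by
      have hne' : (Finset.univ.filter fun i => c i ≠ 0).Nonempty := by
        obtain ⟨i, hi⟩ := Function.ne_iff.mp hne
        exact ⟨i, by simpa using hi⟩
      refine ⟨Finset.max' _ hne', by simpa using Finset.max'_mem _ hne', fun i hi => ?_⟩
      by_contra h
      exact absurd (Finset.le_max' (Finset.univ.filter fun i => c i ≠ 0) i (by simpa using h))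
        (not_le.mpr hi)
    have h1 : f ((N ^ (j : ℕ)) (Ψ c)) = 0 := congrFun hc j
    rw [hΨ, map_sum, map_sum, Finset.sum_eq_single j] at h1
    · rw [map_smul, map_smul, ← Module.End.mul_apply, ← pow_add,
        Nat.add_sub_cancel' (by omega)] at h1
      rcases smul_eq_zero.mp h1 with h | h
      exacts [hj h, hf h]
    · intro i _ hij
      rcases lt_or_gt_of_ne hij with h | h
      · rw [map_smul, ← Module.End.mul_apply, ← pow_add, hbig _ (by omega)]
        simp
      · simp [hmax i h]
    · simp
  have hsurj : Function.Surjective (Φ ∘ₗ Ψ) := LinearMap.injective_iff_surjective.mp hinj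
  have hΦ : Function.Surjective Φ := fun x => (hsurj x).imp' Ψ fun _ h => h
  have hrank : (k + 1) + Module.finrank ℝ (LinearMap.ker Φ) = d := by
    have := Φ.finrank_range_add_finrank_ker
    rw [LinearMap.range_eq_top.mpr hΦ, finrank_top, hd] at this
    simpa using this
  have hmem : ∀ w ∈ LinearMap.ker Φ, N w ∈ LinearMap.ker Φ := by
    intro w hw
    rw [LinearMap.mem_ker] at hw ⊢
    ext i
    change f ((N ^ (i : ℕ)) (N w)) = 0
    rw [← Module.End.mul_apply, ← pow_succ]
    rcases Nat.lt_or_ge ((i : ℕ) + 1) (k + 1) with h | h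
    · exact congrFun hw ⟨i + 1, h⟩
    · rw [hbig _ (by omega)]; simp
  obtain ⟨δ', e', hδ', h0', hs', hspan'⟩ := ih _ (by omega)
    (N.restrict hmem) (Module.End.isNilpotent.restrict hmem hN) rfl
  set d' := Module.finrank ℝ (LinearMap.ker Φ) with hd'
  refine ⟨fun i => if i < k + 1 then 1 else if i = k + 1 then 0 else δ' (i - (k + 1)),
    fun i => if i < k + 1 then (N ^ (k - i)) v else (e' (i - (k + 1)) : V), ?_, ?_, ?_, ?_⟩
  · intro i
    dsimp only
    split_ifs
    exacts [Or.inr rfl, Or.inl rfl, hδ' _]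
  · intro _
    simp only [Nat.zero_lt_succ, if_true, Nat.sub_zero]
    rw [← Module.End.mul_apply, ← pow_succ', hk2]; rfl
  · intro i hi
    dsimp only
    rcases Nat.lt_trichotomy (i + 1) (k + 1) with h | h | h
    · rw [if_pos h, if_pos h, if_pos (by omega), one_smul, ← Module.End.mul_apply, ← pow_succ']
      congr 2
      omega
    · rw [if_neg (by omega), if_neg (by omega), if_pos h, zero_smul, h, Nat.sub_self]
      simpa using congrArg Subtype.val (h0' (by omega))
    · rw [if_neg (by omega), if_neg (by omega), if_neg (by omega), if_neg (by omega)]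
      have := congrArg Subtype.val (hs' (i - (k + 1)) (by omega))
      rw [show i + 1 - (k + 1) = i - (k + 1) + 1 by omega]
      simpa using this
  · intro w
    obtain ⟨c, hc⟩ := hsurj (Φ w)
    have hker : w - Ψ c ∈ LinearMap.ker Φ := by
      rw [LinearMap.mem_ker, map_sub, sub_eq_zero]; exact hc.symm
    obtain ⟨c', hc'⟩ := hspan' ⟨_, hker⟩
    have hc'' := congrArg Subtype.val hc'
    simp only [AddSubmonoidClass.coe_finsetSum, Submodule.coe_smul] at hc''
    refine ⟨fun i => if h : i < k + 1 then c ⟨i, h⟩ else c' (i - (k + 1)), ?_⟩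
    rw [← hrank, Finset.sum_range_add, sub_eq_iff_eq_add'.mp hc'']
    refine congrArg₂ (· + ·) ?_ (Finset.sum_congr rfl fun i _ => by
      simp [show ¬ k + 1 + i ≤ k by omega])
    rw [hΨ, Finset.sum_range]
    exact Finset.sum_congr rfl fun i _ => by simp [Fin.is_le i]

/-- The Jordan basis of a nilpotent endomorphism, as a single list of vectors. If the kernel is at
most one-dimensional, the list is a single chain. -/
theorem exists_jordan_basis {V : Type*} [AddCommGroup V] [Module ℝ V] [FiniteDimensional ℝ V]
    (N : Module.End ℝ V) (hN : IsNilpotent N) {m : ℕ} (hm : Module.finrank ℝ V = m) :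
    ∃ (δ : Fin m → ℝ) (e : Fin m → V), (∀ i, δ i = 0 ∨ δ i = 1) ∧
      (Module.finrank ℝ (LinearMap.ker N) ≤ 1 → ∀ i : Fin m, (i : ℕ) ≠ 0 → δ i = 1) ∧
      LinearIndependent ℝ e ∧ ∀ i, N (e i) = chainPrev δ e i := by
  obtain ⟨δ, e, hδ, h0, hs, hspan⟩ := exists_jordan_sequence m N hN hm
  have hli : LinearIndependent ℝ fun i : Fin m => e i := by
    refine linearIndependent_of_top_le_span_of_card_eq_finrank (fun v _ => ?_) (by simp [hm])
    obtain ⟨c, rfl⟩ := hspan v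
    refine Submodule.sum_mem _ fun i hi => Submodule.smul_mem _ _ (Submodule.subset_span ?_)
    exact ⟨⟨i, Finset.mem_range.mp hi⟩, rfl⟩
  have hchain : ∀ i : Fin m,
      N (e i) = chainPrev (fun i : Fin m => δ i) (fun i : Fin m => e i) i := by
    rintro ⟨i, hi⟩
    rcases i with _ | i
    · simpa [chainPrev] using h0 hi
    · simpa [chainPrev] using hs i hi
  refine ⟨fun i => δ i, fun i => e i, fun i => hδ i, fun h1 i hi => ?_, hli, hchain⟩
  by_contra hne
  have hzero : δ i = 0 := (hδ i).resolve_right hne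
  have hpos : 0 < m := i.pos
  -- a vanishing `δ i` yields the independent vectors `e 0`, `e i` in the kernel
  have hk0 : e 0 ∈ LinearMap.ker N := h0 hpos
  have hki : e i ∈ LinearMap.ker N := by
    rw [LinearMap.mem_ker, hchain i]
    simp [chainPrev, hi, hzero]
  obtain ⟨⟨w, _⟩, hw⟩ := finrank_le_one_iff.mp h1
  obtain ⟨a, ha⟩ := hw ⟨_, hk0⟩
  obtain ⟨b, hb⟩ := hw ⟨_, hki⟩
  replace ha : a • w = e 0 := congrArg Subtype.val ha
  replace hb : b • w = e i := congrArg Subtype.val hb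
  have h0i : (⟨0, hpos⟩ : Fin m) ≠ i := fun h => hi (by simp [← h])
  have hpair : LinearIndepOn ℝ (fun i : Fin m => e i) {⟨0, hpos⟩, i} := hli.linearIndepOn _
  have hb0 : b = 0 := by
    have := (LinearIndepOn.pair_iff (fun i : Fin m => e i) h0i).mp hpair b (-a) (by
      simp only [← ha, ← hb, smul_smul]; module)
    exact this.1
  exact hli.ne_zero i (by simp [← hb, hb0])

theorem exp_eq_sum_of_pow_eq_zero {A : Type*} [NormedRing A] [NormedAlgebra ℝ A]
    [CompleteSpace A] {c : A} {k : ℕ} (hc : c ^ k = 0) :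
    NormedSpace.exp c = ∑ i ∈ Finset.range k, ((i.factorial : ℝ)⁻¹) • c ^ i := by
  rw [NormedSpace.exp_eq_tsum ℝ]
  refine tsum_eq_sum fun i hi => ?_
  rw [pow_eq_zero_of_le (by simpa using hi) hc, smul_zero]

/-- The exponential of a nilpotent element, to second order. -/
theorem exp_eq_one_add_add_sq_mul {A : Type*} [NormedRing A] [NormedAlgebra ℝ A]
    [CompleteSpace A] {c : A} (hc : IsNilpotent c) :
    ∃ w : A, (∀ x, Commute x c → Commute x w) ∧ NormedSpace.exp c = 1 + c + c ^ 2 * w := by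
  obtain ⟨k, hk⟩ := hc
  refine ⟨∑ i ∈ Finset.range k, (((i + 2).factorial : ℝ)⁻¹) • c ^ i, fun x hx => ?_, ?_⟩
  · exact Commute.sum_right _ _ _ fun i _ => (hx.pow_right i).smul_right _
  · rw [exp_eq_sum_of_pow_eq_zero (pow_eq_zero_of_le (by omega : k ≤ k + 2) hk),
      Finset.sum_range_succ', Finset.sum_range_succ', Finset.mul_sum]
    simp only [mul_smul_comm, ← pow_add, Nat.add_comm 2]
    simp only [zero_add, Nat.factorial, Nat.cast_one, inv_one, pow_one, one_smul, pow_zero,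
      mul_one, add_assoc, Nat.reduceAdd]
    abel

/-- A unipotent element `1 + c` has a nilpotent logarithm, commuting with everything that commutes
with `c`. By induction on the order of nilpotency: `exp (-c) * (1 + c)` equals `1` up to a multiple
of `c ^ 2`, which is nilpotent of smaller order. -/
theorem exists_nilpotent_exp_eq_one_add {A : Type*} [NormedRing A] [NormedAlgebra ℝ A]
    [CompleteSpace A] (n : ℕ) : ∀ c : A, c ^ n = 0 →
    ∃ b : A, IsNilpotent b ∧ NormedSpace.exp b = 1 + c ∧ ∀ x, Commute x c → Commute x b := by
  let _ : NormedAlgebra ℚ A := NormedAlgebra.restrictScalars ℚ ℝ A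
  induction n using Nat.strong_induction_on with
  | _ n ih =>
  intro c hc
  rcases Nat.lt_or_ge n 2 with hn | hn
  · have hc0 : c = 0 := by simpa using pow_eq_zero_of_le (by omega : n ≤ 1) hc
    exact ⟨0, IsNilpotent.zero, by simp [hc0], fun x _ => Commute.zero_right x⟩
  obtain ⟨w, hw, hexp⟩ := exp_eq_one_add_add_sq_mul (c := -c) (IsNilpotent.neg ⟨n, hc⟩)
  have hcw : Commute c w := hw c (Commute.refl c).neg_right
  have hc' : NormedSpace.exp (-c) * (1 + c) = 1 + c ^ 2 * (w * (1 + c) - 1) := by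
    rw [hexp]; noncomm_ring
  have hcomm : ∀ x, Commute x c → Commute x (c ^ 2 * (w * (1 + c) - 1)) := fun x hx =>
    (hx.pow_right 2).mul_right
      (((hw x hx.neg_right).mul_right ((Commute.one_right x).add_right hx)).sub_right
        (Commute.one_right x))
  have hcu : Commute (c ^ 2) (w * (1 + c) - 1) :=
    Commute.pow_left ((hcw.mul_right ((Commute.one_right c).add_right (Commute.refl c))).sub_right
        (Commute.one_right c)) 2
  obtain ⟨b, hb, hbexp, hbc⟩ := ih (n - 1) (by omega) (c ^ 2 * (w * (1 + c) - 1)) (by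
    rw [hcu.mul_pow, ← pow_mul, pow_eq_zero_of_le (by omega) hc, zero_mul])
  have hcb : Commute c b := hbc c (hcomm c (Commute.refl c))
  refine ⟨c + b, hcb.isNilpotent_add ⟨n, hc⟩ hb, ?_,
    fun x hx => hx.add_right (hbc x (hcomm x hx))⟩
  rw [NormedSpace.exp_add_of_commute hcb, hbexp, ← hc', ← mul_assoc,
    ← NormedSpace.exp_add_of_commute (Commute.refl c).neg_right, add_neg_cancel,
    NormedSpace.exp_zero, one_mul]

/-- Let `M` have the single eigenvalue `lam < 0`. Then `M = -exp (T (σ + B))` with `B` nilpotent,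
and for a Jordan basis `e` of `B` the curves `c i t = exp (-t (σ + B)) (e i)` solve the chain
equations and satisfy `M (c i (t + T)) = - c i t`. -/
theorem exists_antiperiodic_jordan_curves {E : Type*} [NormedAddCommGroup E] [NormedSpace ℝ E]
    [FiniteDimensional ℝ E] (M : Module.End ℝ E) {lam σ T : ℝ} (hlam : lam < 0) (hT : 0 < T)
    (hσ : Real.exp (σ * T) = |lam|) (hM : IsNilpotent (M - lam • (1 : Module.End ℝ E)))
    {m : ℕ} (hm : Module.finrank ℝ E = m) :
    ∃ (δ : Fin m → ℝ) (c : Fin m → ℝ → E), (∀ i, δ i = 0 ∨ δ i = 1) ∧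
      (Module.finrank ℝ (LinearMap.ker (M - lam • (1 : Module.End ℝ E))) ≤ 1 →
        ∀ i : Fin m, (i : ℕ) ≠ 0 → δ i = 1) ∧
      (∀ i, ContDiff ℝ ⊤ (c i)) ∧
      (∀ i t, HasDerivAt (c i) (-(σ • c i t + chainPrev δ (fun j => c j t) i)) t) ∧
      (∀ i t, M (c i (t + T)) = -c i t) ∧
      ∀ t, LinearIndependent ℝ fun i => c i t := by
  have : CompleteSpace E := FiniteDimensional.complete ℝ E
  let _ : NormedAlgebra ℚ (E →L[ℝ] E) := NormedAlgebra.restrictScalars ℚ ℝ _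
  let A : Module.End ℝ E ≃ₐ[ℝ] (E →L[ℝ] E) := Module.End.toContinuousLinearMap E
  have hlam0 : lam ≠ 0 := hlam.ne
  set N : Module.End ℝ E := M - lam • (1 : Module.End ℝ E) with hNdef
  obtain ⟨r, hr⟩ := hM
  obtain ⟨b, hb, hbexp, hbc⟩ := exists_nilpotent_exp_eq_one_add r (lam⁻¹ • A N) (by
    rw [smul_pow, ← map_pow, hr, map_zero, smul_zero])
  have hAM : A M = lam • NormedSpace.exp b := by
    rw [hbexp, smul_add, smul_inv_smul₀ hlam0, hNdef, map_sub, map_smul, map_one]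
    abel
  set B : E →L[ℝ] E := T⁻¹ • b with hB
  have hbB : b = T • B := by rw [hB, smul_inv_smul₀ hT.ne']
  have hA : ∀ (G : Module.End ℝ E) v, A G v = G v := fun _ _ => rfl
  have hBnil : IsNilpotent (A.symm B) := (hb.smul T⁻¹).map A.symm
  obtain ⟨δ, e, hδ, hgeom, hli, hchain⟩ := exists_jordan_basis (A.symm B) hBnil hm
  -- `exp b` fixes the kernel of `b`, so the geometric multiplicity of `B` is at most that of `M`
  have hker : LinearMap.ker (A.symm B) ≤ LinearMap.ker N := by
    intro v hv
    have hBv : B v = 0 := hv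
    have hbv : b v = 0 := by
      rw [hbB]; simp [hBv]
    obtain ⟨w, hw, hexpb⟩ := exp_eq_one_add_add_sq_mul hb
    have hbw : b ^ 2 * w = w * b ^ 2 := ((hw b (Commute.refl b)).pow_left 2).eq
    have h1 : (NormedSpace.exp b) v = v := by
      rw [hexpb, hbw]
      simp [pow_two, hbv]
    rw [hbexp] at h1
    simpa [hA, hlam0] using h1
  set G : E →L[ℝ] E := -(σ • 1 + B) with hG
  have hGe : ∀ i, G (e i) = -(σ • e i + chainPrev δ e i) := fun i => by
    rw [← hchain i]; rfl
  have hprev : ∀ (H : E →L[ℝ] E) i, H (chainPrev δ e i) = chainPrev δ (fun j => H (e j)) i := by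
    intro H i
    unfold chainPrev
    split_ifs <;> simp
  -- `M = lam • exp b` and `exp (T • G) = |lam|⁻¹ • exp (-b)`
  have hT1 : A M * NormedSpace.exp (T • G) = -1 := by
    have h1 : T • G = algebraMap ℝ (E →L[ℝ] E) (-(σ * T)) + -b := by
      rw [hG, hbB, Algebra.algebraMap_eq_smul_one]; module
    rw [h1, NormedSpace.exp_add_of_commute (Algebra.commutes _ _),
      ← NormedSpace.algebraMap_exp_comm, hAM, Algebra.algebraMap_eq_smul_one, smul_mul_assoc,
      smul_mul_assoc, one_mul, mul_smul_comm, smul_smul,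
      ← NormedSpace.exp_add_of_commute (Commute.refl b).neg_right, add_neg_cancel,
      NormedSpace.exp_zero, ← Real.exp_eq_exp_ℝ, Real.exp_neg, hσ, abs_of_neg hlam, inv_neg,
      mul_neg, mul_inv_cancel₀ hlam0, neg_one_smul]
  refine ⟨δ, fun i t => NormedSpace.exp (t • G) (e i), hδ,
    fun h => hgeom ((Submodule.finrank_mono hker).trans h), fun i => ?_, fun i t => ?_,
    fun i t => ?_, fun t => ?_⟩
  · have h1 : ContDiff ℝ ⊤ (NormedSpace.exp : (E →L[ℝ] E) → _) :=
      AnalyticOnNhd.contDiff fun x _ => NormedSpace.exp_analytic (𝕂 := ℝ) x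
    exact (h1.comp (contDiff_id.smul contDiff_const)).clm_apply contDiff_const
  · have h1 := (hasDerivAt_exp_smul_const (𝕂 := ℝ) G t).clm_apply (hasDerivAt_const t (e i))
    simp only [map_zero, add_zero] at h1
    convert h1 using 1
    change _ = NormedSpace.exp (t • G) (G (e i))
    rw [hGe, map_neg, map_add, map_smul, hprev]
  · change (A M * NormedSpace.exp ((t + T) • G)) (e i) = _
    rw [add_smul, add_comm, NormedSpace.exp_add_of_commute
      (((Commute.refl G).smul_left T).smul_right t), ← mul_assoc, hT1]
    simp
  · have hinj : Function.Injective (NormedSpace.exp (t • G) : E →L[ℝ] E) := by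
      have := NormedSpace.isUnit_exp (t • G)
      exact (ContinuousLinearMap.isUnit_iff_bijective.mp this).1
    exact hli.map' (NormedSpace.exp (t • G) : E →L[ℝ] E).toLinearMap (LinearMap.ker_eq_bot.mpr hinj)

end PeriodicDDE

/-! ### Spectral projections of operators with a compact power -/

namespace PeriodicDDE

section Riesz

variable {X : Type*} [NormedAddCommGroup X] [NormedSpace ℝ X]

/-- The powers of `K - μ` are compact perturbations of scalars. -/
theorem isCompactOperator_smul_one_add (K : X →L[ℝ] X) (hK : IsCompactOperator K) (μ : ℝ)
    (p : ℕ) :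
    ∃ C : X →L[ℝ] X, IsCompactOperator C ∧ (K - μ • 1) ^ p = (-μ) ^ p • 1 + C := by
  induction p with
  | zero => exact ⟨0, isCompactOperator_zero, by simp⟩
  | succ p ih =>
    obtain ⟨C, hC, hp⟩ := ih
    refine ⟨(-μ) ^ p • K + (K - μ • 1) * C, ?_, ?_⟩
    · have h1 : ⇑((K - μ • 1) * C) = ⇑(K - μ • 1) ∘ ⇑C := rfl
      exact (hK.smul ((-μ) ^ p)).add (f := ⇑((-μ) ^ p • K)) (h1 ▸ hC.clm_comp (K - μ • 1))
    · rw [pow_succ', hp, mul_add, mul_smul_comm, mul_one, pow_succ]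
      module

theorem finiteDimensional_ker_of_compact (c : ℝ) (hc : c ≠ 0) (C : X →L[ℝ] X)
    (hC : IsCompactOperator C) :
    FiniteDimensional ℝ (LinearMap.ker ((c • 1 + C : X →L[ℝ] X) : X →ₗ[ℝ] X)) := by
  set W := LinearMap.ker ((c • 1 + C : X →L[ℝ] X) : X →ₗ[ℝ] X) with hW
  have hCw : ∀ w ∈ W, (C : X →ₗ[ℝ] X) w = -(c • w) := by
    intro w hw
    have : c • w + C w = 0 := hw
    exact (eq_neg_of_add_eq_zero_right this)
  have hmem : ∀ w ∈ W, (C : X →ₗ[ℝ] X) w ∈ W := fun w hw => by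
    rw [hCw w hw]; exact W.neg_mem (W.smul_mem c hw)
  have hcl : IsClosed (W : Set X) := ContinuousLinearMap.isClosed_ker _
  have h1 : IsCompactOperator ((C : X →ₗ[ℝ] X).restrict hmem) :=
    IsCompactOperator.restrict (f := (C : X →ₗ[ℝ] X)) hC hmem hcl
  refine FiniteDimensional.of_isCompactOperator_id (𝕜 := ℝ) ?_
  convert! h1.smul (-c)⁻¹ using 1
  ext w
  simp [hCw w w.2, LinearMap.restrict_apply, hc, smul_smul]

theorem disjoint_ker_pow_range_pow_iff {V : Type*} [AddCommGroup V] [Module ℝ V]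
    (A : Module.End ℝ V) (q : ℕ) :
    Disjoint (LinearMap.ker (A ^ q)) (LinearMap.range (A ^ q)) ↔
      LinearMap.ker (A ^ (2 * q)) ≤ LinearMap.ker (A ^ q) := by
  rw [Submodule.disjoint_def, two_mul, pow_add]
  constructor
  · intro h x hx
    exact h _ hx ⟨x, rfl⟩
  · rintro h _ hx ⟨y, rfl⟩
    exact h hx

/-- The kernels of the powers of `K - μ` are eventually constant. Otherwise the Riesz lemma gives
unit vectors `x p` in successive kernels whose images under `K` stay at mutual distance
at least `|μ| / 2`. -/
theorem exists_ker_pow_succ_eq (K : X →L[ℝ] X) (hK : IsCompactOperator K) {μ : ℝ} (hμ : μ ≠ 0) :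
    ∃ p : ℕ, LinearMap.ker (((K - μ • 1 : X →L[ℝ] X) : Module.End ℝ X) ^ (p + 1)) ≤
      LinearMap.ker (((K - μ • 1 : X →L[ℝ] X) : Module.End ℝ X) ^ p) := by
  by_contra! hne
  set B : X →L[ℝ] X := K - μ • 1 with hB
  have hcl : ∀ p, IsClosed (LinearMap.ker ((B : Module.End ℝ X) ^ p) : Set X) := fun p => by
    rw [← ContinuousLinearMap.toLinearMap_pow]
    exact ContinuousLinearMap.isClosed_ker _
  have hmono : ∀ {p q : ℕ}, p ≤ q → LinearMap.ker ((B : Module.End ℝ X) ^ p) ≤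
      LinearMap.ker ((B : Module.End ℝ X) ^ q) := fun {p q} h x hx => by
    rw [← Nat.sub_add_cancel h, pow_add, LinearMap.mem_ker, Module.End.mul_apply,
      LinearMap.mem_ker.mp hx, map_zero]
  have hB1 : ∀ {p : ℕ} {x : X}, x ∈ LinearMap.ker ((B : Module.End ℝ X) ^ (p + 1)) →
      B x ∈ LinearMap.ker ((B : Module.End ℝ X) ^ p) := fun {p x} hx => by
    rw [pow_succ] at hx; exact hx
  -- almost orthogonal vectors in the successive kernels
  have hx : ∀ p : ℕ, ∃ x ∈ LinearMap.ker ((B : Module.End ℝ X) ^ (p + 1)), ‖x‖ = 1 ∧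
      ∀ y ∈ LinearMap.ker ((B : Module.End ℝ X) ^ p), 1 / 2 ≤ ‖x - y‖ := by
    intro p
    set W := LinearMap.ker ((B : Module.End ℝ X) ^ (p + 1)) with hW
    obtain ⟨z, hz, hzn⟩ := Set.not_subset.mp (hne p)
    obtain ⟨x, -, hx1, hx2⟩ := riesz_lemma_of_lt_one (𝕜 := ℝ) (E := W)
      (F := (LinearMap.ker ((B : Module.End ℝ X) ^ p)).comap W.subtype)
      ((hcl p).preimage continuous_subtype_val) ⟨⟨z, hz⟩, hzn⟩ (r := 1 / 2) (by norm_num)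
    exact ⟨x, x.2, hx1, fun y hy => hx2 ⟨y, hmono (Nat.le_succ p) hy⟩ hy⟩
  choose x hxk hxn hxd using hx
  have hKB : ∀ y, K y = B y + μ • y := fun y => by simp [hB]
  have hsep : ∀ p q : ℕ, p < q → |μ| / 2 ≤ ‖K (x q) - K (x p)‖ := by
    intro p q hpq
    have hmem : μ⁻¹ • (K (x p) - B (x q)) ∈ LinearMap.ker ((B : Module.End ℝ X) ^ q) := by
      refine Submodule.smul_mem _ _ (Submodule.sub_mem _ ?_ (hB1 (hxk q)))
      rw [hKB]
      exact Submodule.add_mem _ (hmono (by omega) (hB1 (hxk p)))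
        (Submodule.smul_mem _ _ (hmono hpq (hxk p)))
    have h1 := hxd q _ hmem
    have h2 : K (x q) - K (x p) = μ • (x q - μ⁻¹ • (K (x p) - B (x q))) := by
      rw [smul_sub, smul_inv_smul₀ hμ, hKB (x q)]; abel
    rw [h2, norm_smul, Real.norm_eq_abs]
    nlinarith [abs_nonneg μ]
  obtain ⟨S, hS, hS'⟩ :=
    IsCompactOperator.image_closedBall_subset_compact (f := (K : X →ₗ[ℝ] X)) hK 1
  obtain ⟨y, -, ψ, hψ, hψy⟩ := hS.tendsto_subseq
    (fun p => hS' ⟨x p, by simp [hxn p], rfl⟩)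
  obtain ⟨n, hn⟩ := Metric.cauchySeq_iff'.mp hψy.cauchySeq (|μ| / 2) (by positivity)
  have h3 := hn (n + 1) (Nat.le_succ n)
  rw [dist_eq_norm] at h3
  exact absurd h3 (not_lt.mpr (hsep _ _ (hψ (Nat.lt_succ_self n))))

theorem ker_pow_le_of_ker_pow_succ_le {V : Type*} [AddCommGroup V] [Module ℝ V]
    (A : Module.End ℝ V) {p : ℕ} (h : LinearMap.ker (A ^ (p + 1)) ≤ LinearMap.ker (A ^ p)) (j : ℕ) :
    LinearMap.ker (A ^ (p + j)) ≤ LinearMap.ker (A ^ p) := by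
  induction j with
  | zero => exact le_rfl
  | succ j ih =>
    intro x hx
    refine h ?_
    have : A x ∈ LinearMap.ker (A ^ (p + j)) := by
      rw [← add_assoc, pow_succ] at hx; exact hx
    have := ih this
    rw [pow_succ]; exact this

theorem ker_pow_succ_le_of_disjoint {V : Type*} [AddCommGroup V] [Module ℝ V]
    (A : Module.End ℝ V) {p : ℕ} (hp : 0 < p)
    (h : Disjoint (LinearMap.ker (A ^ p)) (LinearMap.range (A ^ p))) :
    LinearMap.ker (A ^ (p + 1)) ≤ LinearMap.ker (A ^ p) := by
  intro x hx
  refine Submodule.disjoint_def.mp h _ ?_ ⟨x, rfl⟩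
  obtain ⟨r, rfl⟩ := Nat.exists_eq_succ_of_ne_zero hp.ne'
  rw [LinearMap.mem_ker, ← Module.End.mul_apply, ← pow_add,
    show r.succ + r.succ = r + (r.succ + 1) by omega, pow_add, Module.End.mul_apply,
    LinearMap.mem_ker.mp hx, map_zero]

/-- If the kernel and the range of a compact perturbation `S` of a nonzero scalar meet trivially,
they are complementary: with a continuous projection `π` onto the kernel, `S + π` is injective,
hence bijective by the Fredholm alternative. -/
theorem isCompl_ker_range_of_disjoint [CompleteSpace X] {S C : X →L[ℝ] X} {c : ℝ} (hc : c ≠ 0)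
    (hC : IsCompactOperator C) (hpC : S = c • 1 + C)
    [FiniteDimensional ℝ (LinearMap.ker (S : X →ₗ[ℝ] X))]
    (hdisj : Disjoint (LinearMap.ker (S : X →ₗ[ℝ] X)) (LinearMap.range (S : X →ₗ[ℝ] X))) :
    IsCompl (LinearMap.ker (S : X →ₗ[ℝ] X)) (LinearMap.range (S : X →ₗ[ℝ] X)) := by
  refine ⟨hdisj, codisjoint_iff.mpr (eq_top_iff.mpr fun x _ => ?_)⟩
  obtain ⟨π, hπ⟩ := Submodule.ClosedComplemented.of_finiteDimensional (𝕜 := ℝ)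
    (LinearMap.ker (S : X →ₗ[ℝ] X))
  -- `S + π` is a compact perturbation of a nonzero scalar, and it is injective
  set R : X →L[ℝ] X := C + (LinearMap.ker (S : X →ₗ[ℝ] X)).subtypeL ∘L π with hR
  have hRc : IsCompactOperator R :=
    hC.add ((isCompactOperator_of_locallyCompactSpace_rng
      (LinearMap.ker (S : X →ₗ[ℝ] X)).subtypeL).comp_clm π)
  have hSR : ∀ y, S y + π y = R y + c • y := fun y => by
    have h1 : S y = c • y + C y := by rw [hpC]; rfl
    rw [h1, hR]
    simp only [add_apply, ContinuousLinearMap.comp_apply,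
      Submodule.subtypeL_apply]
    abel
  have hinj : ∀ y, S y + π y = 0 → y = 0 := by
    intro y hy
    have h1 : S y ∈ LinearMap.ker (S : X →ₗ[ℝ] X) := by
      rw [eq_neg_of_add_eq_zero_left hy]; exact Submodule.neg_mem _ (π y).2
    have h2 : S y = 0 := Submodule.disjoint_def.mp hdisj _ h1 ⟨y, rfl⟩
    rw [h2, zero_add] at hy
    have h3 := hπ ⟨y, h2⟩
    rw [Submodule.coe_eq_zero.mp hy] at h3
    exact congrArg Subtype.val h3.symm
  rcases hRc.hasEigenvalue_or_mem_resolventSet (μ := -c) (neg_ne_zero.mpr hc) with h | h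
  · obtain ⟨v, hv⟩ := h.exists_hasEigenvector
    refine absurd (hinj v ?_) hv.2
    have h4 : R v = (-c) • v := hv.apply_eq_smul
    rw [hSR, h4]; module
  · rw [spectrum.mem_resolventSet_iff, ContinuousLinearMap.isUnit_iff_bijective] at h
    obtain ⟨y, hy⟩ := h.2 (-x)
    have h5 : S y + π y = x := by
      rw [hSR, ← neg_neg x, ← hy]
      simp [Algebra.algebraMap_eq_smul_one]
    rw [← h5, add_comm]
    exact Submodule.add_mem_sup (π y).2 ⟨y, rfl⟩

theorem exists_isCompl_ker_range_of_compact [CompleteSpace X] (K : X →L[ℝ] X)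
    (hK : IsCompactOperator K) {μ : ℝ} (hμ : μ ≠ 0) :
    ∃ p : ℕ, 0 < p ∧
      FiniteDimensional ℝ (LinearMap.ker (((K - μ • 1 : X →L[ℝ] X) : Module.End ℝ X) ^ p)) ∧
      IsCompl (LinearMap.ker (((K - μ • 1 : X →L[ℝ] X) : Module.End ℝ X) ^ p))
        (LinearMap.range (((K - μ • 1 : X →L[ℝ] X) : Module.End ℝ X) ^ p)) := by
  obtain ⟨p, hp⟩ := exists_ker_pow_succ_eq K hK hμ
  refine ⟨p + 1, p.succ_pos, ?_⟩
  set B : Module.End ℝ X := ((K - μ • 1 : X →L[ℝ] X) : Module.End ℝ X) with hB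
  have hdisj := (disjoint_ker_pow_range_pow_iff B (p + 1)).mpr fun x hx => by
    rw [show 2 * (p + 1) = p + (p + 2) by omega] at hx
    have h1 := ker_pow_le_of_ker_pow_succ_le _ hp (p + 2) hx
    rw [pow_succ', LinearMap.mem_ker, Module.End.mul_apply, LinearMap.mem_ker.mp h1, map_zero]
  obtain ⟨C, hC, hpC⟩ := isCompactOperator_smul_one_add K hK μ (p + 1)
  rw [hB, ← ContinuousLinearMap.toLinearMap_pow] at hdisj ⊢
  have hc : (-μ) ^ (p + 1) ≠ 0 := pow_ne_zero _ (neg_ne_zero.mpr hμ)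
  have hfd : FiniteDimensional ℝ
      (LinearMap.ker (((K - μ • 1) ^ (p + 1) : X →L[ℝ] X) : X →ₗ[ℝ] X)) := by
    rw [hpC]; exact finiteDimensional_ker_of_compact _ hc C hC
  exact ⟨hfd, isCompl_ker_range_of_disjoint hc hC hpC hdisj⟩

theorem isClosed_range_of_isCompl [CompleteSpace X] (S : X →L[ℝ] X)
    [FiniteDimensional ℝ (LinearMap.ker (S : X →ₗ[ℝ] X))]
    (hS : IsCompl (LinearMap.ker (S : X →ₗ[ℝ] X)) (LinearMap.range (S : X →ₗ[ℝ] X))) :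
    IsClosed (LinearMap.range (S : X →ₗ[ℝ] X) : Set X) := by
  obtain ⟨π, hπ⟩ := Submodule.ClosedComplemented.of_finiteDimensional (𝕜 := ℝ)
    (LinearMap.ker (S : X →ₗ[ℝ] X))
  set Z := LinearMap.ker (π : X →ₗ[ℝ] LinearMap.ker (S : X →ₗ[ℝ] X)) with hZ
  have hZc : IsClosed (Z : Set X) := ContinuousLinearMap.isClosed_ker π
  have : CompleteSpace Z := hZc.completeSpace_coe
  set f : Z →L[ℝ] X := S ∘L Z.subtypeL with hf
  have hr : LinearMap.range (f : Z →ₗ[ℝ] X) = LinearMap.range (S : X →ₗ[ℝ] X) := by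
    apply le_antisymm
    · rintro _ ⟨z, rfl⟩; exact ⟨z, rfl⟩
    · rintro _ ⟨x, rfl⟩
      have hSπ : S (π x) = 0 := (π x).2
      refine ⟨⟨x - π x, ?_⟩, ?_⟩
      · change π (x - π x) = 0
        rw [map_sub, hπ, sub_self]
      · simp [hf, hSπ]
  rw [← hr]
  refine ContinuousLinearMap.closed_complemented_range_of_isCompl_of_ker_eq_bot f
    (LinearMap.ker (S : X →ₗ[ℝ] X)) (hr ▸ hS.symm) (ContinuousLinearMap.isClosed_ker S) ?_
  rw [LinearMap.ker_eq_bot']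
  rintro ⟨z, hz⟩ hzS
  have h1 : (z : X) ∈ LinearMap.ker (S : X →ₗ[ℝ] X) := hzS
  have h2 : π z = 0 := hz
  have h3 := hπ ⟨z, h1⟩
  rw [h2] at h3
  exact Subtype.ext (congrArg Subtype.val h3.symm : (z : X) = 0)

theorem exists_projection_of_isCompl [CompleteSpace X] (S : X →L[ℝ] X)
    [FiniteDimensional ℝ (LinearMap.ker (S : X →ₗ[ℝ] X))]
    (hS : IsCompl (LinearMap.ker (S : X →ₗ[ℝ] X)) (LinearMap.range (S : X →ₗ[ℝ] X))) :
    ∃ P : X →L[ℝ] X, P ∘L P = P ∧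
      LinearMap.range (P : X →ₗ[ℝ] X) = LinearMap.ker (S : X →ₗ[ℝ] X) ∧
      ∀ M : X →L[ℝ] X, M ∘L S = S ∘L M → P ∘L M = M ∘L P := by
  have h := Submodule.IsCompl.isTopCompl_of_isClosed hS (ContinuousLinearMap.isClosed_ker S)
    (isClosed_range_of_isCompl S hS)
  set P := Submodule.projectionL _ _ h with hP
  have hPc : ∀ x, P x = Submodule.projection _ _ hS x := fun x => rfl
  refine ⟨P, ?_, ?_, fun M hM => ?_⟩
  · ext x
    exact congrArg (· x) (Submodule.isIdempotentElem_projection hS)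
  · exact Submodule.range_projection hS
  · have hM' : ∀ x, M (S x) = S (M x) := fun x => congrArg (· x) hM
    ext x
    simp only [ContinuousLinearMap.comp_apply, hPc]
    have h1 : M (Submodule.projection _ _ hS x) ∈ LinearMap.ker (S : X →ₗ[ℝ] X) := by
      have h2 : S (Submodule.projection _ _ hS x) = 0 := Submodule.projection_apply_mem hS x
      change S (M _) = 0
      rw [← hM', h2, map_zero]
    obtain ⟨y, hy⟩ := Submodule.sub_projection_mem hS x
    have hy' : S y = x - Submodule.projection _ _ hS x := hy
    have h3 : M x = M (Submodule.projection _ _ hS x) + S (M y) := by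
      rw [← hM', hy', map_sub]; abel
    rw [h3, map_add, Submodule.projection_apply_of_mem_left hS h1,
      show Submodule.projection _ _ hS (S (M y)) = 0 from
        (Submodule.projection_apply_eq_zero_iff hS).mpr ⟨M y, rfl⟩, add_zero]

/-- A decomposition of the space into the kernel and the range of a power of `A * Q`, with
finite-dimensional kernel, yields one for a commuting factor `A`: on the range `A` is surjective,
and on the kernel the Fitting decomposition applies. -/
theorem isCompl_ker_range_of_mul {V : Type*} [AddCommGroup V] [Module ℝ V]
    {A Q : Module.End ℝ V} (hAQ : Commute A Q) {p : ℕ} (hp : 0 < p)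
    [FiniteDimensional ℝ (LinearMap.ker ((A * Q) ^ p))]
    (hB : IsCompl (LinearMap.ker ((A * Q) ^ p)) (LinearMap.range ((A * Q) ^ p))) :
    ∃ q : ℕ, 0 < q ∧ FiniteDimensional ℝ (LinearMap.ker (A ^ q)) ∧
      IsCompl (LinearMap.ker (A ^ q)) (LinearMap.range (A ^ q)) := by
  set W := LinearMap.ker ((A * Q) ^ p) with hW
  have hAB : Commute A ((A * Q) ^ p) := ((Commute.refl A).mul_right hAQ).pow_right p
  have hmem : ∀ w ∈ W, A w ∈ W := fun w hw => by
    rw [hW, LinearMap.mem_ker, ← Module.End.mul_apply, ← hAB.eq, Module.End.mul_apply,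
      LinearMap.mem_ker.mp hw, map_zero]
  -- all powers of `A Q` beyond the `p`-th have the kernel and the range of the `p`-th
  have hrange : ∀ j, LinearMap.range ((A * Q) ^ p) ≤ LinearMap.range ((A * Q) ^ (p + j * p)) := by
    intro j
    induction j with
    | zero => simp
    | succ j ih =>
      rintro _ ⟨x, rfl⟩
      obtain ⟨y, hy, z, ⟨u, rfl⟩, rfl⟩ := Submodule.mem_sup.mp
        (hB.sup_eq_top ▸ Submodule.mem_top : x ∈ W ⊔ LinearMap.range ((A * Q) ^ p))
      obtain ⟨v, hv⟩ := ih ⟨u, rfl⟩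
      refine ⟨v, ?_⟩
      rw [map_add, LinearMap.mem_ker.mp hy, zero_add, ← hv, ← Module.End.mul_apply, ← pow_add]
      congr 2
      ring
  have hker : ∀ j, LinearMap.ker (A ^ j) ≤ W := by
    intro j x hx
    refine ker_pow_le_of_ker_pow_succ_le (A * Q) (ker_pow_succ_le_of_disjoint _ hp hB.disjoint) j ?_
    rw [LinearMap.mem_ker, pow_add, hAQ.mul_pow j, (hAQ.pow_pow j j).eq, Module.End.mul_apply,
      Module.End.mul_apply, LinearMap.mem_ker.mp hx, map_zero, map_zero]
  -- Fitting decomposition of the restriction of `A` to the kernel of `(A Q) ^ p`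
  obtain ⟨q, hq, hqp⟩ := ((A.restrict hmem).eventually_isCompl_ker_pow_range_pow.and
    (Filter.eventually_ge_atTop 1)).exists
  have hres : ∀ (j : ℕ) (w : W), (((A.restrict hmem) ^ j) w : V) = (A ^ j) w := fun j w => by
    rw [Module.End.pow_restrict]; rfl
  refine ⟨q, hqp, Submodule.finiteDimensional_of_le (hker q), ?_, ?_⟩
  · rw [Submodule.disjoint_def]
    rintro _ hx ⟨y, rfl⟩
    have hy : y ∈ W := hker (q + q) (by rw [pow_add]; exact hx)
    have h0 : ((A.restrict hmem) ^ q) ⟨y, hy⟩ = 0 :=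
      Submodule.disjoint_def.mp hq.disjoint _
        (Subtype.ext (by rw [hres, hres]; exact hx)) ⟨_, rfl⟩
    rw [← hres q ⟨y, hy⟩, h0]; rfl
  · rw [codisjoint_iff, eq_top_iff]
    intro x _
    obtain ⟨w, hw, z, ⟨u, rfl⟩, rfl⟩ := Submodule.mem_sup.mp
        (hB.sup_eq_top ▸ Submodule.mem_top : x ∈ W ⊔ LinearMap.range ((A * Q) ^ p))
    refine Submodule.add_mem _ ?_ (Submodule.mem_sup_right ?_)
    · obtain ⟨a, ha, b, ⟨c, hc⟩, hab⟩ := Submodule.mem_sup.mp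
        (hq.sup_eq_top ▸ Submodule.mem_top : (⟨w, hw⟩ : W) ∈ _ ⊔ _)
      have hab' : (a : V) + b = w := congrArg Subtype.val hab
      rw [← hab']
      refine Submodule.add_mem_sup ?_ ⟨c, ?_⟩
      · rw [LinearMap.mem_ker, ← hres, LinearMap.mem_ker.mp ha]; rfl
      · rw [← hres, hc]
    · obtain ⟨v, hv⟩ := hrange q ⟨u, rfl⟩
      rw [← hv]
      have hle : q ≤ p + q * p := by nlinarith
      refine ⟨(A ^ (p + q * p - q) * Q ^ (p + q * p)) v, ?_⟩
      rw [← Module.End.mul_apply, ← mul_assoc, ← pow_add, Nat.add_sub_cancel' hle, hAQ.mul_pow]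

/-- The spectral projection at a nonzero `lam` of a bounded operator with a compact power. The
operator `M - lam` is a factor of `M ^ N - lam ^ N`, for which the Riesz theory of compact operators
gives the decomposition into kernel and range. -/
theorem exists_spectral_projection [CompleteSpace X] (M : X →L[ℝ] X) {N : ℕ}
    (hM : IsCompactOperator (M ^ N : X →L[ℝ] X)) {lam : ℝ} (hlam : lam ≠ 0) :
    FiniteDimensional ℝ (Module.End.maxGenEigenspace (M : Module.End ℝ X) lam) ∧
    ∃ P : X →L[ℝ] X, P ∘L P = P ∧
      LinearMap.range (P : X →ₗ[ℝ] X) = Module.End.maxGenEigenspace (M : Module.End ℝ X) lam ∧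
      P ∘L M = M ∘L P := by
  obtain ⟨p, hp, hfd, hcompl⟩ := exists_isCompl_ker_range_of_compact (M ^ N) hM
    (pow_ne_zero N hlam)
  set A : Module.End ℝ X := (M : Module.End ℝ X) - lam • 1 with hA
  set Q : Module.End ℝ X := ∑ i ∈ Finset.range N, (M : Module.End ℝ X) ^ i * (lam • 1) ^ (N - 1 - i)
  have hcomm : Commute (M : Module.End ℝ X) (lam • (1 : Module.End ℝ X)) :=
    (Commute.one_right _).smul_right lam
  have hAM : Commute A (M : Module.End ℝ X) := (Commute.refl _).sub_left hcomm.symm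
  have hAl : Commute A (lam • (1 : Module.End ℝ X)) := (Commute.one_right _).smul_right lam
  have hAQ : Commute A Q := Commute.sum_right _ _ _ fun i _ =>
    (hAM.pow_right i).mul_right (hAl.pow_right _)
  have hprod : A * Q = ((M ^ N - lam ^ N • 1 : X →L[ℝ] X) : Module.End ℝ X) := by
    rw [hcomm.mul_geom_sum₂, smul_pow, one_pow, ← ContinuousLinearMap.toLinearMap_pow]
    rfl
  rw [← hprod] at hfd hcompl
  obtain ⟨q, hq, hfdq, hcq⟩ := isCompl_ker_range_of_mul hAQ hp hcompl
  have hgen : Module.End.maxGenEigenspace (M : Module.End ℝ X) lam = LinearMap.ker (A ^ q) := by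
    ext x
    rw [Module.End.mem_maxGenEigenspace]
    refine ⟨fun ⟨j, hj⟩ => ?_, fun hx => ⟨q, hx⟩⟩
    refine ker_pow_le_of_ker_pow_succ_le A (ker_pow_succ_le_of_disjoint _ hq hcq.disjoint) j ?_
    rw [LinearMap.mem_ker, pow_add, Module.End.mul_apply]
    exact (congrArg _ hj).trans (map_zero _)
  have hAq : A ^ q = (((M - lam • 1) ^ q : X →L[ℝ] X) : Module.End ℝ X) := by
    rw [ContinuousLinearMap.toLinearMap_pow]; rfl
  rw [hgen]
  rw [hAq] at hfdq hcq ⊢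
  obtain ⟨P, hP1, hP2, hP3⟩ := exists_projection_of_isCompl _ hcq
  refine ⟨hfdq, P, hP1, hP2, hP3 M ?_⟩
  have : Commute M ((M - lam • 1) ^ q) :=
    ((Commute.refl M).sub_right ((Commute.one_right M).smul_right lam)).pow_right q
  exact this.eq

end Riesz

end PeriodicDDE

/-! ### The linear delay equation and its monodromy operator -/

namespace PeriodicDDE

section Hist

variable {h : ℝ} {n : ℕ}

theorem hist_apply (x : C(ℝ, Vec n)) (t : ℝ) (θ : Set.Icc (-h) (0 : ℝ)) :
    hist h x t θ = x (t + θ) := rfl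

theorem hist_add (x y : C(ℝ, Vec n)) (t : ℝ) : hist h (x + y) t = hist h x t + hist h y t := rfl

theorem hist_sub (x y : C(ℝ, Vec n)) (t : ℝ) : hist h (x - y) t = hist h x t - hist h y t := rfl

theorem hist_smul (c : ℝ) (x : C(ℝ, Vec n)) (t : ℝ) : hist h (c • x) t = c • hist h x t := rfl

theorem continuous_hist (x : C(ℝ, Vec n)) : Continuous (hist h x) := by
  let f : C(ℝ × Set.Icc (-h) (0 : ℝ), Vec n) := ⟨fun p => x (p.1 + p.2), by fun_prop⟩
  exact f.curry.continuous

theorem norm_hist_le {x : C(ℝ, Vec n)} {t c : ℝ} (hc : 0 ≤ c)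
    (H : ∀ r, t - h ≤ r → r ≤ t → ‖x r‖ ≤ c) : ‖hist h x t‖ ≤ c :=
  (ContinuousMap.norm_le _ hc).mpr fun θ => H _ (by linarith [θ.2.1]) (by linarith [θ.2.2])

theorem norm_apply_le_norm_hist {x : C(ℝ, Vec n)} {t r : ℝ} (h1 : t - h ≤ r) (h2 : r ≤ t) :
    ‖x r‖ ≤ ‖hist h x t‖ := by
  have := (hist h x t).norm_coe_le_norm ⟨r - t, by constructor <;> linarith⟩
  simpa [hist_apply] using this

/-- The translate `t ↦ x (t + a)`. -/
def translate (x : C(ℝ, Vec n)) (a : ℝ) : C(ℝ, Vec n) := ⟨fun t => x (t + a), by fun_prop⟩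

theorem translate_apply (x : C(ℝ, Vec n)) (a t : ℝ) : translate x a t = x (t + a) := rfl

theorem hist_translate (x : C(ℝ, Vec n)) (a t : ℝ) :
    hist h (translate x a) t = hist h x (t + a) := by
  ext1 θ
  simp only [hist_apply, translate_apply]
  congr 1
  ring

end Hist

section Solutions

variable {h : ℝ} {n : ℕ} {L : ℝ → State h n →L[ℝ] Vec n}

theorem IsLinearSolution.sub {s : ℝ} {φ ψ : State h n} {x y : C(ℝ, Vec n)}
    (hx : IsLinearSolution L s φ x) (hy : IsLinearSolution L s ψ y) :
    IsLinearSolution L s (φ - ψ) (x - y) := by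
  refine ⟨by rw [hist_sub, hx.1, hy.1], fun t ht => ?_⟩
  rw [hist_sub, map_sub]
  exact (hx.2 t ht).sub (hy.2 t ht)

/-- Restarting a solution at a later time, after a translation by a period. -/
theorem IsLinearSolution.translate {s : ℝ} {φ : State h n} {y : C(ℝ, Vec n)}
    (hy : IsLinearSolution L s φ y) {a s' : ℝ} (hs' : s ≤ s' + a) (ha : ∀ t, L (t + a) = L t) :
    IsLinearSolution L s' (hist h y (s' + a)) (translate y a) := by
  refine ⟨hist_translate y a s', fun t ht => ?_⟩
  rw [hist_translate, ← ha t]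
  have h1 := (hy.2 (t + a) (by linarith)).scomp t (s := Set.Ici s') (h := fun t => t + a)
    ((hasDerivWithinAt_id t _).add_const a) (fun r hr => by
      simp only [Set.mem_Ici] at hr ⊢; linarith)
  rw [one_smul] at h1
  exact h1

/-- Solutions are determined by their initial states: the maximum of `exp (-κ (r - s)) ‖y r‖`, with
`κ > 2 C`, is bounded by half of itself. -/
theorem IsLinearSolution.eq_zero (h_h : 0 ≤ h) {C : ℝ} (hC : ∀ t, ‖L t‖ ≤ C) {s : ℝ}
    {y : C(ℝ, Vec n)} (hy : IsLinearSolution L s 0 y) {t : ℝ} (ht : s - h ≤ t) : y t = 0 := by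
  have hC0 : 0 ≤ C := (norm_nonneg (L 0)).trans (hC 0)
  have hinit : ∀ r, s - h ≤ r → r ≤ s → y r = 0 := fun r h1 h2 => by
    have := norm_apply_le_norm_hist (x := y) h1 h2
    rw [hy.1, norm_zero] at this
    exact norm_le_zero_iff.mp this
  set κ : ℝ := 2 * C + 1 with hκ
  have hκ0 : 0 < κ := by linarith
  -- the maximum of the exponentially weighted norm
  obtain ⟨t₁, ht₁, hmax⟩ := (isCompact_Icc (a := s - h) (b := max t s)).exists_isMaxOn
    (Set.nonempty_Icc.mpr (by linarith [le_max_right t s]))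
    (f := fun r => Real.exp (-(κ * (r - s))) * ‖y r‖) (by fun_prop)
  set m := Real.exp (-(κ * (t₁ - s))) * ‖y t₁‖ with hm
  have hm0 : 0 ≤ m := by positivity
  have hle : ∀ r ∈ Set.Icc (s - h) (max t s), ‖y r‖ ≤ m * Real.exp (κ * (r - s)) := fun r hr => by
    have h1 : Real.exp (-(κ * (r - s))) * ‖y r‖ ≤ m := hmax hr
    rw [Real.exp_neg, inv_mul_le_iff₀ (Real.exp_pos _)] at h1
    linarith
  have hmzero : m = 0 := by
    rcases le_total t₁ s with h1 | h1
    · rw [hm, hinit t₁ ht₁.1 h1]; simp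
    have hB : ∀ r, HasDerivAt (fun r => C / κ * (m * Real.exp (κ * (r - s))))
        (C * (m * Real.exp (κ * (r - s)))) r := fun r => by
      have := (((((hasDerivAt_id r).sub_const s).const_mul κ).exp).const_mul m).const_mul (C / κ)
      refine this.congr_deriv ?_
      simp only [id]
      field_simp
    have h2 := image_norm_le_of_norm_deriv_right_le_deriv_boundary (a := s) (b := max t s)
      (f := y) (f' := fun r => L r (hist h y r)) y.continuous.continuousOn
      (fun r hr => (hy.2 r hr.1).mono (Set.Ici_subset_Ici.mpr hr.1))
      (by rw [hinit s (by linarith) le_rfl, norm_zero]; positivity) hB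
      (fun r hr => by
        refine ((L r).le_opNorm _).trans (mul_le_mul (hC r) ?_ (norm_nonneg _) hC0)
        refine norm_hist_le (by positivity) fun q hq1 hq2 =>
          (hle q ⟨by linarith [hr.1], hq2.trans hr.2.le⟩).trans ?_
        gcongr) ⟨h1, ht₁.2⟩
    have h3 : ‖y t₁‖ = m * Real.exp (κ * (t₁ - s)) := by
      rw [hm, Real.exp_neg]; field_simp
    rw [h3, ← mul_assoc] at h2
    have h4 := le_of_mul_le_mul_right h2 (Real.exp_pos _)
    have h5 : C / κ ≤ 1 / 2 := by rw [div_le_iff₀ hκ0]; linarith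
    nlinarith
  have := hle t ⟨ht, le_max_left _ _⟩
  rw [hmzero, zero_mul] at this
  exact norm_le_zero_iff.mp this

theorem IsLinearSolution.unique (h_h : 0 ≤ h) {C : ℝ} (hC : ∀ t, ‖L t‖ ≤ C) {s : ℝ}
    {φ : State h n} {x y : C(ℝ, Vec n)} (hx : IsLinearSolution L s φ x)
    (hy : IsLinearSolution L s φ y) {t : ℝ} (ht : s - h ≤ t) : x t = y t := by
  have := hx.sub hy
  rw [sub_self] at this
  exact sub_eq_zero.mp (this.eq_zero h_h hC ht)

theorem IsLinearSolution.hist_unique (h_h : 0 ≤ h) {C : ℝ} (hC : ∀ t, ‖L t‖ ≤ C) {s : ℝ}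
    {φ : State h n} {x y : C(ℝ, Vec n)} (hx : IsLinearSolution L s φ x)
    (hy : IsLinearSolution L s φ y) {t : ℝ} (ht : s ≤ t) : hist h x t = hist h y t := by
  ext1 θ
  exact hx.unique h_h hC hy (by linarith [θ.2.1])

end Solutions

section Existence

variable {h : ℝ} {n : ℕ}

open BoundedContinuousFunction

/-- The exponential weight `exp (κ (t - s)⁺)`. -/
noncomputable def weight (κ s t : ℝ) : ℝ := Real.exp (κ * max (t - s) 0)

theorem continuous_weight (κ s : ℝ) : Continuous (weight κ s) := by
  unfold weight; fun_prop

theorem weight_pos (κ s t : ℝ) : 0 < weight κ s t := Real.exp_pos _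

theorem monotone_weight {κ : ℝ} (hκ : 0 ≤ κ) (s : ℝ) : Monotone (weight κ s) := fun a b hab => by
  unfold weight; gcongr

theorem one_le_weight {κ : ℝ} (hκ : 0 ≤ κ) (s t : ℝ) : 1 ≤ weight κ s t :=
  Real.one_le_exp (mul_nonneg hκ (le_max_right _ _))

/-- The product of a bounded continuous function and the weight. -/
noncomputable def weighted (κ s : ℝ) (w : ℝ →ᵇ Vec n) : C(ℝ, Vec n) where
  toFun t := weight κ s t • w t
  continuous_toFun := (continuous_weight κ s).smul w.continuous

theorem norm_hist_weighted_le {κ : ℝ} (hκ : 0 ≤ κ) (s : ℝ) (w : ℝ →ᵇ Vec n) (r : ℝ) :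
    ‖hist h (weighted κ s w) r‖ ≤ weight κ s r * ‖w‖ := by
  refine norm_hist_le (mul_nonneg (weight_pos _ _ _).le (norm_nonneg _)) fun q _ hq => ?_
  change ‖weight κ s q • w q‖ ≤ _
  rw [norm_smul, Real.norm_of_nonneg (weight_pos _ _ _).le]
  exact mul_le_mul (monotone_weight hκ s hq) (w.norm_coe_le_norm q) (norm_nonneg _)
    (weight_pos _ _ _).le

theorem norm_inv_weight_smul_integral_le {L : ℝ → State h n →L[ℝ] Vec n} {C : ℝ}
    (hC : ∀ t, ‖L t‖ ≤ C) {κ : ℝ} (hκ : 0 < κ) (s : ℝ) (w : ℝ →ᵇ Vec n) (t : ℝ) :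
    ‖(weight κ s t)⁻¹ • ∫ r in s..max t s, L r (hist h (weighted κ s w) r)‖ ≤
      C / κ * ‖w‖ := by
  rw [norm_smul, norm_inv, Real.norm_of_nonneg (weight_pos _ _ _).le,
    inv_mul_le_iff₀ (weight_pos _ _ _)]
  have hC0 : 0 ≤ C := (norm_nonneg (L 0)).trans (hC 0)
  have hd : ∀ r, HasDerivAt (fun r => C / κ * ‖w‖ * Real.exp (κ * (r - s)))
      (C * ‖w‖ * Real.exp (κ * (r - s))) r := fun r => by
    have := (((((hasDerivAt_id r).sub_const s).const_mul κ).exp)).const_mul (C / κ * ‖w‖)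
    refine this.congr_deriv ?_
    simp only [id]
    field_simp
  have hint : IntervalIntegrable (fun r => C * ‖w‖ * Real.exp (κ * (r - s))) volume s (max t s) :=
    (by fun_prop : Continuous fun r => C * ‖w‖ * Real.exp (κ * (r - s))).intervalIntegrable _ _
  refine (intervalIntegral.norm_integral_le_of_norm_le (le_max_right t s)
    (Filter.Eventually.of_forall fun r hr => ?_) hint).trans ?_
  · refine ((L r).le_opNorm _).trans ?_
    rw [mul_assoc]
    refine mul_le_mul (hC r) ((norm_hist_weighted_le hκ.le s w r).trans ?_) (norm_nonneg _) hC0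
    rw [weight, max_eq_left (by linarith [hr.1]), mul_comm]
  · rw [intervalIntegral.integral_eq_sub_of_hasDerivAt (fun r _ => hd r) hint]
    have h1 : max t s - s = max (t - s) 0 := by rw [max_sub_sub_right t s s |>.symm, sub_self]
    rw [h1, weight]
    have : 0 ≤ C / κ * ‖w‖ * Real.exp (κ * (s - s)) := by positivity
    linarith

theorem continuous_volterra {L : ℝ → State h n →L[ℝ] Vec n} (hL : Continuous L) (s : ℝ)
    (x : C(ℝ, Vec n)) : Continuous fun t => ∫ r in s..max t s, L r (hist h x r) := by
  have h1 : Continuous fun r => L r (hist h x r) := hL.clm_apply (continuous_hist x)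
  exact (intervalIntegral.continuous_primitive (fun a b => h1.intervalIntegrable a b) s).comp
    (by fun_prop : Continuous fun t => max t s)

/-- The operator `x ↦ ∫ r in s..t, L r x_r`, for functions `x` of growth `weight κ s`, which are
encoded as bounded functions multiplied by the weight. For `t ≤ s` the value is `0`. -/
noncomputable def volterra {L : ℝ → State h n →L[ℝ] Vec n} (hL : Continuous L) {C : ℝ}
    (hC : ∀ t, ‖L t‖ ≤ C) {κ : ℝ} (hκ : 0 < κ) (s : ℝ) : (ℝ →ᵇ Vec n) →L[ℝ] (ℝ →ᵇ Vec n) :=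
  have hint : ∀ (w : ℝ →ᵇ Vec n) a b,
      IntervalIntegrable (fun r => L r (hist h (weighted κ s w) r)) volume a b := fun w a b =>
    (hL.clm_apply (continuous_hist (weighted κ s w))).intervalIntegrable a b
  have hb := norm_inv_weight_smul_integral_le hC hκ s
  LinearMap.mkContinuous
    { toFun := fun w => ofNormedAddCommGroup
        (fun t => (weight κ s t)⁻¹ • ∫ r in s..max t s, L r (hist h (weighted κ s w) r))
        (((continuous_weight κ s).inv₀ fun t => (weight_pos κ s t).ne').smul
          (continuous_volterra hL s _)) (C / κ * ‖w‖) (hb w)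
      map_add' := fun v w => by
        ext1 t
        have h1 : weighted κ s (v + w) = weighted κ s v + weighted κ s w := by
          ext1 t; exact smul_add _ _ _
        simp only [coe_ofNormedAddCommGroup, coe_add, Pi.add_apply, h1, hist_add, map_add]
        rw [intervalIntegral.integral_add (hint v _ _) (hint w _ _), smul_add]
      map_smul' := fun c w => by
        ext1 t
        have h1 : weighted κ s (c • w) = c • weighted κ s w := by
          ext1 t; exact smul_comm (weight κ s t) c (w t)
        simp only [coe_ofNormedAddCommGroup, coe_smul, h1, hist_smul, map_smul, RingHom.id_apply]
        rw [intervalIntegral.integral_smul, smul_comm] }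
    (C / κ) fun w => (norm_le (mul_nonneg
      (div_nonneg ((norm_nonneg (L 0)).trans (hC 0)) hκ.le) (norm_nonneg _))).mpr (hb w)

theorem norm_volterra_le {L : ℝ → State h n →L[ℝ] Vec n} (hL : Continuous L) {C : ℝ}
    (hC : ∀ t, ‖L t‖ ≤ C) {κ : ℝ} (hκ : 0 < κ) (s : ℝ) : ‖volterra hL hC hκ s‖ ≤ C / κ :=
  have hCκ : 0 ≤ C / κ := div_nonneg ((norm_nonneg (L 0)).trans (hC 0)) hκ.le
  ContinuousLinearMap.opNorm_le_bound _ hCκ fun w =>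
    (norm_le (mul_nonneg hCκ (norm_nonneg _))).mpr (norm_inv_weight_smul_integral_le hC hκ s w)

/-- The extension of a state at time `s` to the line, constant on both sides of `[s - h, s]`, divided
by the weight. -/
noncomputable def weightedExtension (h_h : 0 ≤ h) {κ : ℝ} (hκ : 0 ≤ κ) (s : ℝ) :
    State h n →L[ℝ] (ℝ →ᵇ Vec n) :=
  have hb : ∀ (φ : State h n) t, ‖(weight κ s t)⁻¹ •
      φ (Set.projIcc (-h) 0 (neg_nonpos.mpr h_h) (t - s))‖ ≤ 1 * ‖φ‖ := fun φ t => by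
    rw [norm_smul, norm_inv, Real.norm_of_nonneg (weight_pos _ _ _).le]
    exact mul_le_mul (inv_le_one_of_one_le₀ (one_le_weight hκ s t)) (φ.norm_coe_le_norm _)
      (norm_nonneg _) zero_le_one
  LinearMap.mkContinuous
    { toFun := fun φ => ofNormedAddCommGroup
        (fun t => (weight κ s t)⁻¹ • φ (Set.projIcc (-h) 0 (neg_nonpos.mpr h_h) (t - s)))
        (((continuous_weight κ s).inv₀ fun t => (weight_pos κ s t).ne').smul
          (φ.continuous.comp (continuous_projIcc.comp (continuous_id.sub continuous_const))))
        (1 * ‖φ‖) (hb φ)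
      map_add' := fun φ ψ => by ext1 t; exact smul_add _ _ _
      map_smul' := fun c φ => by
        ext1 t
        exact smul_comm (weight κ s t)⁻¹ c (φ (Set.projIcc (-h) 0 (neg_nonpos.mpr h_h) (t - s))) }
    1 fun φ => (norm_le (by positivity)).mpr (hb φ)

/-- Global solvability, linearly in the initial state and with a bound. In the space of functions of
growth `exp (κ (t - s)⁺)`, with `κ = C + 1`, the Volterra operator has norm less than one, so the
integral equation is solved by a Neumann series. -/
theorem exists_solution_map (h_h : 0 ≤ h) {L : ℝ → State h n →L[ℝ] Vec n} (hL : Continuous L)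
    {C : ℝ} (hC : ∀ t, ‖L t‖ ≤ C) (s : ℝ) :
    ∃ (Y : State h n →ₗ[ℝ] C(ℝ, Vec n)) (b : ℝ → ℝ), Monotone b ∧ (∀ t, 0 ≤ b t) ∧
      (∀ φ, IsLinearSolution L s φ (Y φ)) ∧ ∀ φ t, ‖Y φ t‖ ≤ b t * ‖φ‖ := by
  have hC0 : 0 ≤ C := (norm_nonneg (L 0)).trans (hC 0)
  have hκ : 0 < C + 1 := by linarith
  set K := volterra hL hC hκ s with hK
  have hKn : ‖K‖ < 1 := by
    refine (norm_volterra_le hL hC hκ s).trans_lt ?_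
    rw [div_lt_one hκ]; linarith
  obtain ⟨u, hu⟩ := isUnit_one_sub_of_norm_lt_one (R := (ℝ →ᵇ Vec n) →L[ℝ] (ℝ →ᵇ Vec n)) hKn
  set R : (ℝ →ᵇ Vec n) →L[ℝ] (ℝ →ᵇ Vec n) := ↑u⁻¹ with hR
  have hRK : ∀ w, R w = w + K (R w) := fun w => by
    have h1 : (1 - K) * R = 1 := by rw [← hu, hR, Units.mul_inv]
    have h2 : R w - K (R w) = w := congrArg (fun A => A w) h1
    exact sub_eq_iff_eq_add.mp h2
  set ι := weightedExtension (n := n) h_h hκ.le s with hι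
  let Y : State h n →ₗ[ℝ] C(ℝ, Vec n) :=
    { toFun := fun φ => weighted (C + 1) s (R (ι φ))
      map_add' := fun φ ψ => by
        ext1 t
        simp only [map_add]
        exact smul_add _ _ _
      map_smul' := fun c φ => by
        ext1 t
        simp only [map_smul]
        exact smul_comm (weight (C + 1) s t) c (R (ι φ) t) }
  -- the integral equation satisfied by `Y φ`
  have hY : ∀ φ t, Y φ t = φ (Set.projIcc (-h) 0 (neg_nonpos.mpr h_h) (t - s)) +
      ∫ r in s..max t s, L r (hist h (Y φ) r) := fun φ t => by
    have h1 : Y φ t = weight (C + 1) s t • (ι φ t + K (R (ι φ)) t) := by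
      rw [← BoundedContinuousFunction.add_apply, ← hRK]; rfl
    have h2 : ι φ t = (weight (C + 1) s t)⁻¹ •
      φ (Set.projIcc (-h) 0 (neg_nonpos.mpr h_h) (t - s)) := rfl
    have h3 : K (R (ι φ)) t = (weight (C + 1) s t)⁻¹ •
      ∫ r in s..max t s, L r (hist h (Y φ) r) := rfl
    rw [h1, h2, h3, ← smul_add, smul_inv_smul₀ (weight_pos _ _ _).ne']
  refine ⟨Y, fun t => weight (C + 1) s t * (‖R‖ * ‖ι‖),
    fun a b hab => mul_le_mul_of_nonneg_right (monotone_weight hκ.le s hab) (by positivity),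
    fun t => mul_nonneg (weight_pos _ _ _).le (by positivity), fun φ => ⟨?_, fun t ht => ?_⟩,
    fun φ t => ?_⟩
  · ext1 θ
    rw [hist_apply, hY, max_eq_right (by linarith [θ.2.2]), intervalIntegral.integral_same, add_zero,
      add_sub_cancel_left, Set.projIcc_val]
  · have hc : Continuous fun r => L r (hist h (Y φ) r) := hL.clm_apply (continuous_hist _)
    have h1 := ((hc.integral_hasStrictDerivAt s t).hasDerivAt.const_add
      (φ ⟨0, neg_nonpos.mpr h_h, le_rfl⟩)).hasDerivWithinAt (s := Set.Ici s)
    refine h1.congr_of_mem (fun r hr => ?_) ht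
    rw [hY, max_eq_left hr, Set.projIcc_of_right_le _ (sub_nonneg.mpr hr)]
  · change ‖weight (C + 1) s t • R (ι φ) t‖ ≤ _
    rw [norm_smul, Real.norm_of_nonneg (weight_pos _ _ _).le, mul_assoc]
    gcongr
    · exact (weight_pos _ _ _).le
    · exact ((R (ι φ)).norm_coe_le_norm t).trans ((R.le_opNorm_of_le (ι.le_opNorm φ)).trans_eq
        (mul_assoc _ _ _).symm)

theorem exists_isLinearSolution (h_h : 0 ≤ h) {L : ℝ → State h n →L[ℝ] Vec n} (hL : Continuous L)
    {C : ℝ} (hC : ∀ t, ‖L t‖ ≤ C) (s : ℝ) (φ : State h n) : ∃ y, IsLinearSolution L s φ y :=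
  let ⟨Y, _, _, _, hY, _⟩ := exists_solution_map h_h hL hC s
  ⟨Y φ, hY φ⟩

theorem exists_isSolutionOperator (h_h : 0 ≤ h) {L : ℝ → State h n →L[ℝ] Vec n}
    (hL : Continuous L) {C : ℝ} (hC : ∀ t, ‖L t‖ ≤ C) (t s : ℝ) :
    ∃ A, IsSolutionOperator L t s A := by
  obtain ⟨Y, b, hbm, hb0, hY, hYb⟩ := exists_solution_map h_h hL hC s
  refine ⟨LinearMap.mkContinuous
    { toFun := fun φ => hist h (Y φ) t
      map_add' := fun φ ψ => by rw [map_add, hist_add]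
      map_smul' := fun c φ => by rw [map_smul, hist_smul]; rfl } (b t) fun φ => ?_,
    fun φ => ⟨Y φ, hY φ, rfl⟩⟩
  exact norm_hist_le (mul_nonneg (hb0 t) (norm_nonneg _)) fun r _ hr => (hYb φ r).trans
    (mul_le_mul_of_nonneg_right (hbm hr) (norm_nonneg _))

theorem IsLinearSolution.evolution_apply (h_h : 0 ≤ h) {L : ℝ → State h n →L[ℝ] Vec n}
    (hL : Continuous L) {C : ℝ} (hC : ∀ t, ‖L t‖ ≤ C) {t s : ℝ} (hst : s ≤ t) {φ : State h n}
    {y : C(ℝ, Vec n)} (hy : IsLinearSolution L s φ y) : evolution L t s φ = hist h y t := by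
  have hA := exists_isSolutionOperator h_h hL hC t s
  obtain ⟨z, hz, hzt⟩ := hA.choose_spec φ
  rw [evolution, dif_pos hA, ← hzt]
  exact hz.hist_unique h_h hC hy hst

end Existence

section Monodromy

variable {h : ℝ} {n : ℕ} {L : ℝ → State h n →L[ℝ] Vec n} {C T : ℝ}

theorem IsLinearSolution.monodromy_apply (h_h : 0 ≤ h) (hL : Continuous L) (hC : ∀ t, ‖L t‖ ≤ C)
    (hT : 0 < T) {s : ℝ} {φ : State h n} {y : C(ℝ, Vec n)} (hy : IsLinearSolution L s φ y) :
    monodromy L T s φ = hist h y (s + T) :=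
  hy.evolution_apply h_h hL hC (by linarith)

theorem periodic_add_nat_mul {α : Type*} {f : ℝ → α} (hf : ∀ t, f (t + T) = f t) (N : ℕ) (t : ℝ) :
    f (t + N * T) = f t :=
  (Function.Periodic.nat_mul hf N) t

theorem IsLinearSolution.monodromy_pow_apply (h_h : 0 ≤ h) (hL : Continuous L)
    (hC : ∀ t, ‖L t‖ ≤ C) (hT : 0 < T) (hLT : ∀ t, L (t + T) = L t) {s : ℝ} {φ : State h n}
    {y : C(ℝ, Vec n)} (hy : IsLinearSolution L s φ y) (N : ℕ) :
    (monodromy L T s ^ N) φ = hist h y (s + N * T) := by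
  induction N with
  | zero => simpa using hy.1.symm
  | succ N ih =>
    have h1 := hy.translate (a := N * T) (s' := s) (le_add_of_nonneg_right (by positivity))
      (periodic_add_nat_mul hLT N)
    rw [pow_succ', mul_apply_eq_comp, ih, h1.monodromy_apply h_h hL hC hT,
      hist_translate]
    congr 1
    push_cast
    ring

theorem monodromy_add_period (h_h : 0 ≤ h) (hL : Continuous L) (hC : ∀ t, ‖L t‖ ≤ C) (hT : 0 < T)
    (hLT : ∀ t, L (t + T) = L t) (s : ℝ) : monodromy L T (s + T) = monodromy L T s := by
  ext1 φ
  obtain ⟨y, hy⟩ := exists_isLinearSolution h_h hL hC (s + T) φ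
  have h1 := hy.translate (a := T) (s' := s) le_rfl hLT
  rw [hy.1] at h1
  rw [hy.monodromy_apply h_h hL hC hT, h1.monodromy_apply h_h hL hC hT, hist_translate]

/-- An Arzelà–Ascoli criterion: the images of the unit vectors have a common Lipschitz constant. -/
theorem isCompactOperator_of_lipschitzWith {E D V : Type*} [NormedAddCommGroup E] [NormedSpace ℝ E]
    [PseudoMetricSpace D] [CompactSpace D] [NormedAddCommGroup V] [NormedSpace ℝ V]
    [FiniteDimensional ℝ V] (A : E →L[ℝ] C(D, V)) (K : NNReal)
    (hK : ∀ φ, ‖φ‖ ≤ 1 → LipschitzWith K (A φ)) : IsCompactOperator A := by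
  have : ProperSpace V := FiniteDimensional.proper ℝ V
  refine (isCompactOperator_iff_isCompact_closure_image_closedBall (A : E →ₗ[ℝ] C(D, V))
    zero_lt_one).mpr ?_
  let e := (ContinuousMap.isometryEquivBoundedOfCompact D V).toHomeomorph
  rw [← e.isCompact_image, e.image_closure]
  refine BoundedContinuousFunction.arzela_ascoli (Metric.closedBall 0 ‖A‖)
    (isCompact_closedBall _ _) _ ?_ ?_
  · rintro _ x ⟨_, ⟨φ, hφ, rfl⟩, rfl⟩
    rw [mem_closedBall_zero_iff] at hφ ⊢
    exact ((A φ).norm_coe_le_norm x).trans (A.unit_le_opNorm φ hφ)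
  · refine (LipschitzWith.uniformEquicontinuous _ K ?_).equicontinuous
    rintro ⟨_, ⟨_, ⟨φ, hφ, rfl⟩, rfl⟩⟩
    exact hK φ (mem_closedBall_zero_iff.mp hφ)

/-- As soon as `N * T ≥ h`, the solution on `[s + N T - h, s + N T]` satisfies the equation there, so
it is Lipschitz with a constant controlled by the initial state. -/
theorem exists_isCompactOperator_monodromy_pow (h_h : 0 ≤ h) (hL : Continuous L)
    (hC : ∀ t, ‖L t‖ ≤ C) (hT : 0 < T) (hLT : ∀ t, L (t + T) = L t) (s : ℝ) :
    ∃ N : ℕ, IsCompactOperator (monodromy L T s ^ N : State h n →L[ℝ] State h n) := by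
  have hC0 : 0 ≤ C := (norm_nonneg (L 0)).trans (hC 0)
  obtain ⟨N, hN⟩ := exists_nat_ge (h / T)
  rw [div_le_iff₀ hT] at hN
  obtain ⟨Y, b, hbm, hb0, hY, hYb⟩ := exists_solution_map h_h hL hC s
  refine ⟨N, isCompactOperator_of_lipschitzWith _ (C * b (s + N * T)).toNNReal fun φ hφ => ?_⟩
  rw [(hY φ).monodromy_pow_apply h_h hL hC hT hLT]
  have h1 : ∀ r ∈ Set.Icc s (s + N * T), ‖L r (hist h (Y φ) r)‖ ≤ C * b (s + N * T) := by
    intro r hr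
    refine ((L r).le_opNorm _).trans (mul_le_mul (hC r) ?_ (norm_nonneg _) hC0)
    exact norm_hist_le (hb0 _) fun q _ hq => (hYb φ q).trans
      ((mul_le_of_le_one_right (hb0 q) hφ).trans (hbm (hq.trans hr.2)))
  refine LipschitzWith.of_dist_le_mul fun θ₁ θ₂ => ?_
  rw [dist_eq_norm, Real.coe_toNNReal _ (mul_nonneg hC0 (hb0 _)), hist_apply, hist_apply]
  refine (Convex.norm_image_sub_le_of_norm_hasDerivWithin_le (s := Set.Icc s (s + N * T))
    (fun r hr => ((hY φ).2 r hr.1).mono Set.Icc_subset_Ici_self) h1 (convex_Icc _ _)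
    ⟨by linarith [θ₂.2.1], by linarith [θ₂.2.2]⟩
    ⟨by linarith [θ₁.2.1], by linarith [θ₁.2.2]⟩).trans_eq ?_
  rw [Subtype.dist_eq, Real.dist_eq, Real.norm_eq_abs]
  congr 2
  ring

end Monodromy

end PeriodicDDE

/-! ### Smoothness and entire solutions -/

namespace PeriodicDDE

section Regularity

variable {h : ℝ} {n : ℕ}

/-- For continuously differentiable `x` the history is differentiable for the supremum norm. -/
theorem hasDerivAt_hist {x x' : C(ℝ, Vec n)} (hx : ∀ t, HasDerivAt x (x' t) t) (t : ℝ) :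
    HasDerivAt (hist h x) (hist h x' t) t := by
  have hc : Continuous (hist h x') := continuous_hist x'
  have h1 : hist h x = fun u => hist h x 0 + ∫ r in (0 : ℝ)..u, hist h x' r := by
    funext u
    ext1 θ
    have h2 := (ContinuousMap.evalCLM ℝ θ).intervalIntegral_comp_comm
      (hc.intervalIntegrable (μ := volume) 0 u)
    change _ = hist h x 0 θ + (ContinuousMap.evalCLM ℝ θ) (∫ r in (0 : ℝ)..u, hist h x' r)
    rw [← h2]
    have h3 : ∀ r ∈ Set.uIcc 0 u, HasDerivAt (fun r => x (r + θ)) (x' (r + θ)) r :=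
      fun r _ => (hx (r + θ)).comp_add_const r θ
    have h4 := intervalIntegral.integral_eq_sub_of_hasDerivAt h3
      ((by fun_prop : Continuous fun r => x' (r + (θ : ℝ))).intervalIntegrable _ _)
    change x (u + θ) = x (0 + θ) + ∫ r in (0 : ℝ)..u, x' (r + θ)
    rw [h4]
    abel
  rw [h1]
  exact ((hc.integral_hasStrictDerivAt 0 t).hasDerivAt).const_add _

theorem contDiff_hist (m : ℕ) : ∀ x : C(ℝ, Vec n), ContDiff ℝ m x → ContDiff ℝ m (hist h x) := by
  induction m with
  | zero => exact fun x _ => contDiff_zero.mpr (continuous_hist x)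
  | succ m ih =>
    intro x hx
    have hx' := (contDiff_succ_iff_deriv (n := m)).mp (by exact_mod_cast hx)
    let x' : C(ℝ, Vec n) := ⟨deriv x, hx'.2.2.continuous⟩
    have hd := hasDerivAt_hist (h := h) (x := x) (x' := x') fun t => (hx'.1 t).hasDerivAt
    have h1 : ContDiff ℝ ((m : ℕ∞) + 1 : WithTop ℕ∞) (hist h x) := by
      refine (contDiff_succ_iff_deriv (n := m)).mpr ⟨fun t => (hd t).differentiableAt, by simp, ?_⟩
      rw [show deriv (hist h x) = hist h x' from funext fun t => (hd t).deriv]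
      exact ih x' hx'.2.2
    exact_mod_cast h1

/-- Bootstrapping: a solution of a delay equation is one order smoother than the equation. -/
theorem contDiff_of_hasDerivAt_hist {k : ℕ} {G : ℝ → State h n → Vec n} {x : C(ℝ, Vec n)}
    (hx : ∀ t, HasDerivAt x (G t (hist h x t)) t)
    (hG : ∀ m : ℕ, m ≤ k → ContDiff ℝ m (hist h x) → ContDiff ℝ m fun t => G t (hist h x t)) :
    ContDiff ℝ (k + 1) x := by
  have h1 : ∀ m : ℕ, m ≤ k + 1 → ContDiff ℝ m x := by
    intro m
    induction m with
    | zero => exact fun _ => contDiff_zero.mpr x.continuous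
    | succ m ih =>
      intro hm
      have h2 : ContDiff ℝ ((m : ℕ∞) + 1 : WithTop ℕ∞) x := by
        refine (contDiff_succ_iff_deriv (n := m)).mpr
          ⟨fun t => (hx t).differentiableAt, by simp, ?_⟩
        rw [show deriv x = fun t => G t (hist h x t) from funext fun t => (hx t).deriv]
        exact hG m (by omega) (contDiff_hist m x (ih (by omega)))
      exact_mod_cast h2
  exact_mod_cast h1 (k + 1) le_rfl

end Regularity

section Linearization

variable {h : ℝ} {n k : ℕ} {F : State h n → Vec n} {γ : C(ℝ, Vec n)} {T : ℝ}

theorem contDiff_linearization (hF : ContDiff ℝ (k + 1) F) (hγ : IsPeriodicSolution F γ T) :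
    ContDiff ℝ k (linearization F γ) := by
  have h1 : ContDiff ℝ (k + 1) γ := contDiff_of_hasDerivAt_hist (G := fun _ => F) hγ.solves
    fun m hm hx => (hF.of_le (by exact_mod_cast (by omega : m ≤ k + 1))).comp hx
  have h2 : ContDiff ℝ k (hist h γ) :=
    contDiff_hist k γ (h1.of_le (by exact_mod_cast k.le_succ))
  exact (hF.fderiv_right (m := k) le_rfl).comp h2

theorem linearization_add_period (hγ : IsPeriodicSolution F γ T) (t : ℝ) :
    linearization F γ (t + T) = linearization F γ t := by
  have : hist h γ (t + T) = hist h γ t := by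
    ext1 θ
    rw [hist_apply, hist_apply, ← hγ.periodic (t + θ)]
    congr 1; ring
  rw [linearization, this, linearization]

theorem exists_norm_le_of_periodic {E : Type*} [NormedAddCommGroup E] {f : ℝ → E}
    (hf : Continuous f) (hT : 0 < T) (hp : ∀ t, f (t + T) = f t) : ∃ C, ∀ t, ‖f t‖ ≤ C := by
  obtain ⟨C, hC⟩ := (isCompact_Icc (a := 0) (b := T)).exists_bound_of_continuousOn hf.continuousOn
  refine ⟨C, fun t => ?_⟩
  obtain ⟨r, hr, hrt⟩ := Function.Periodic.exists_mem_Ico₀ (f := f) hp hT t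
  rw [hrt]
  exact hC r ⟨hr.1, hr.2.le⟩

end Linearization

section Extension

variable {h : ℝ} {n : ℕ} {L : ℝ → State h n →L[ℝ] Vec n} {C T : ℝ}

/-- Solutions of `x'(t) = L(t) x_t` on the whole line. -/
def IsEntireSolution (L : ℝ → State h n →L[ℝ] Vec n) (x : C(ℝ, Vec n)) : Prop :=
  ∀ t, HasDerivAt x (L t (hist h x t)) t

theorem IsEntireSolution.isLinearSolution {x : C(ℝ, Vec n)} (hx : IsEntireSolution L x) (s : ℝ) :
    IsLinearSolution L s (hist h x s) x :=
  ⟨rfl, fun t _ => (hx t).hasDerivWithinAt⟩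

/-- On a subspace `E` invariant under an invertible monodromy operator, solutions extend backwards to
the whole line: the extension through `ξ` is, at time `t`, the forward solution through `M⁻ⁱ ξ` at
time `t + i T`, for any sufficiently large `i`. -/
theorem exists_entire_extension (h_h : 0 ≤ h) (hL : Continuous L) (hC : ∀ t, ‖L t‖ ≤ C)
    (hT : 0 < T) (hLT : ∀ t, L (t + T) = L t) (s : ℝ) {E : Submodule ℝ (State h n)}
    (M : E ≃ₗ[ℝ] E) (hM : ∀ ξ, (M ξ : State h n) = monodromy L T s ξ) :
    ∃ X : E →ₗ[ℝ] C(ℝ, Vec n), (∀ ξ, IsEntireSolution L (X ξ)) ∧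
      (∀ ξ, hist h (X ξ) s = ξ) ∧ ∀ ξ t, hist h (X ξ) (t + T) = hist h (X (M ξ)) t := by
  obtain ⟨Y, -, -, -, hY, -⟩ := exists_solution_map h_h hL hC s
  set R : Module.End ℝ E := M.symm.toLinearMap with hR
  -- one step back along `R` is compensated by one more period
  have hstep : ∀ ξ r, s - h ≤ r → Y (R ξ) (r + T) = Y ξ r := by
    intro ξ r hr
    have h1 := (hY (R ξ)).translate (a := T) (s' := s) (by linarith) hLT
    have h2 : hist h (Y (R ξ)) (s + T) = ξ := by
      rw [← (hY (R ξ)).monodromy_apply h_h hL hC hT, ← hM]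
      simp [hR]
    rw [h2] at h1
    exact h1.unique h_h hC (hY ξ) hr
  have hsteps : ∀ (i : ℕ) ξ r, s - h ≤ r → Y ((R ^ i) ξ) (r + i * T) = Y ξ r := by
    intro i
    induction i with
    | zero => intro ξ r _; simp
    | succ i ih =>
      intro ξ r hr
      have h1 := hstep ((R ^ i) ξ) (r + i * T) (hr.trans (le_add_of_nonneg_right (by positivity)))
      rw [ih ξ r hr] at h1
      rw [← h1, pow_succ', Module.End.mul_apply]
      congr 1
      push_cast
      ring
  -- `J t` periods suffice to move `t` past `s`
  let J : ℝ → ℕ := fun t => ⌈(s - t) / T⌉₊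
  have hJ : ∀ t, s ≤ t + J t * T := fun t => by
    have := (div_le_iff₀ hT).mp (Nat.le_ceil ((s - t) / T))
    linarith
  have hind : ∀ ξ t (i : ℕ), s - h ≤ t + i * T →
      Y ((R ^ J t) ξ) (t + J t * T) = Y ((R ^ i) ξ) (t + i * T) := by
    intro ξ t i hi
    have h1 := hsteps i ((R ^ J t) ξ) (t + J t * T) (by linarith [hJ t])
    have h2 := hsteps (J t) ((R ^ i) ξ) (t + i * T) hi
    rw [← Module.End.mul_apply, ← pow_add] at h1 h2
    rw [← h1, ← h2, add_comm i]
    congr 1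
    ring
  let x : E → ℝ → Vec n := fun ξ t => Y ((R ^ J t) ξ) (t + J t * T)
  have hx : ∀ ξ t (i : ℕ), s - h ≤ t + i * T → x ξ t = Y ((R ^ i) ξ) (t + i * T) := hind
  have hlocal : ∀ ξ t, ∃ i : ℕ, s < t + i * T ∧
      x ξ =ᶠ[nhds t] translate (Y ((R ^ i) ξ)) (i * T) := by
    intro ξ t
    obtain ⟨i, hi⟩ := exists_nat_gt ((s - t) / T)
    rw [div_lt_iff₀ hT] at hi
    refine ⟨i, by linarith, ?_⟩
    filter_upwards [lt_mem_nhds (show s - i * T < t by linarith)] with r hr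
    exact hx ξ r i (by linarith)
  have hcont : ∀ ξ, Continuous (x ξ) := fun ξ => continuous_iff_continuousAt.mpr fun t => by
    obtain ⟨i, -, hi⟩ := hlocal ξ t
    exact (map_continuous (translate (Y ((R ^ i) ξ)) (i * T))).continuousAt.congr hi.symm
  let X : E →ₗ[ℝ] C(ℝ, Vec n) :=
    { toFun := fun ξ => ⟨x ξ, hcont ξ⟩
      map_add' := fun ξ η => by
        ext1 t
        change Y ((R ^ J t) (ξ + η)) (t + J t * T) = _
        rw [map_add (R ^ J t), Submodule.coe_add, map_add Y]; rfl
      map_smul' := fun c ξ => by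
        ext1 t
        change Y ((R ^ J t) (c • ξ)) (t + J t * T) = _
        rw [map_smul, Submodule.coe_smul, map_smul]; rfl }
  have hXx : ∀ ξ t, X ξ t = x ξ t := fun _ _ => rfl
  refine ⟨X, fun ξ t => ?_, fun ξ => ?_, fun ξ t => ?_⟩
  · obtain ⟨i, hi, hxi⟩ := hlocal ξ t
    have h1 : hist h (X ξ) t = hist h (translate (Y ((R ^ i) ξ)) (i * T)) t := by
      ext1 θ
      exact hx ξ _ i (by linarith [θ.2.1])
    rw [h1, hist_translate, ← periodic_add_nat_mul hLT i t]
    have h2 : HasDerivAt (Y ((R ^ i) ξ)) _ (t + i * T) :=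
      ((hY ((R ^ i) ξ)).2 (t + i * T) hi.le).hasDerivAt (Ici_mem_nhds hi)
    exact (h2.comp_add_const t (i * T)).congr_of_eventuallyEq hxi
  · ext1 θ
    have h1 := hx ξ (s + θ) 0 (by simp only [Nat.cast_zero, zero_mul]; linarith [θ.2.1])
    have h2 : Y ξ (s + θ) = (ξ : State h n) θ := congrArg (fun φ : State h n => φ θ) (hY ξ).1
    rw [hist_apply, hXx, h1, ← h2]
    simp
  · ext1 θ
    obtain ⟨i, hi⟩ := exists_nat_gt ((s - (t + θ)) / T)
    rw [div_lt_iff₀ hT] at hi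
    rw [hist_apply, hist_apply, hXx, hXx, hx (M ξ) (t + θ) (i + 1) (by push_cast; linarith),
      hx ξ (t + T + θ) i (by linarith), pow_succ, Module.End.mul_apply]
    have : R (M ξ) = ξ := M.symm_apply_apply ξ
    rw [this]
    congr 1
    push_cast
    ring

end Extension

section Transport

variable {h : ℝ} {n : ℕ} {L : ℝ → State h n →L[ℝ] Vec n} {C T lam : ℝ}

/-- On a finite-dimensional generalized eigenspace at `lam ≠ 0` the endomorphism is invertible, and
its geometric multiplicity at `lam` is not larger than on the whole space. -/
theorem exists_restrict_of_eq_maxGenEigenspace {V : Type*} [AddCommGroup V] [Module ℝ V]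
    (f : Module.End ℝ V) (hlam : lam ≠ 0) {E : Submodule ℝ V} [FiniteDimensional ℝ E]
    (hE : E = f.maxGenEigenspace lam) :
    ∃ M : E ≃ₗ[ℝ] E, (∀ ξ, (M ξ : V) = f ξ) ∧
      IsNilpotent (M.toLinearMap - lam • (1 : Module.End ℝ E)) ∧
      Module.finrank ℝ (LinearMap.ker (M.toLinearMap - lam • (1 : Module.End ℝ E))) ≤
        Module.finrank ℝ (f.eigenspace lam) := by
  have hmaps : ∀ ξ ∈ E, f ξ ∈ E := fun ξ hξ => by
    rw [hE] at hξ ⊢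
    exact Module.End.mapsTo_maxGenEigenspace_of_comm (Commute.refl f) lam hξ
  let g : Module.End ℝ E := f.restrict hmaps
  obtain ⟨N, hN⟩ : ∃ N, N = g - lam • (1 : Module.End ℝ E) := ⟨_, rfl⟩
  have hNv : ∀ ξ : E, (N ξ : V) = (f - lam • (1 : Module.End ℝ V)) ξ := fun ξ => by rw [hN]; rfl
  have hNpow : ∀ (j : ℕ) (ξ : E), ((N ^ j) ξ : V) = ((f - lam • (1 : Module.End ℝ V)) ^ j) ξ := by
    intro j
    induction j with
    | zero => intro ξ; rfl
    | succ j ih =>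
      intro ξ
      rw [pow_succ, Module.End.mul_apply, ih, pow_succ, Module.End.mul_apply, hNv]
  have hnil : IsNilpotent N := by
    refine Module.End.isNilpotent_iff_of_finite.mpr fun ξ => ?_
    obtain ⟨j, hj⟩ := (Module.End.mem_maxGenEigenspace f lam ξ).mp (hE ▸ ξ.2)
    exact ⟨j, Subtype.ext ((hNpow j ξ).trans hj)⟩
  have hunit : IsUnit g := by
    have h1 : g = N + lam • 1 := by rw [hN]; abel
    have h2 : IsUnit (algebraMap ℝ (Module.End ℝ E) lam) := (isUnit_iff_ne_zero.mpr hlam).map _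
    rw [Algebra.algebraMap_eq_smul_one] at h2
    rw [h1]
    exact hnil.isUnit_add_right_of_commute h2 ((Commute.one_right N).smul_right lam)
  obtain ⟨M, hMg⟩ : ∃ M : E ≃ₗ[ℝ] E, M.toLinearMap = g :=
    ⟨LinearEquiv.ofBijective g ((Module.End.isUnit_iff g).mp hunit), rfl⟩
  have hMv : ∀ ξ, (M ξ : V) = f ξ := fun ξ =>
    congrArg (fun A : Module.End ℝ E => (A ξ : V)) hMg
  rw [← hMg] at hN
  refine ⟨M, hMv, hN ▸ hnil, ?_⟩
  rw [← hN]
  have hle : f.eigenspace lam ≤ E := hE ▸ Module.End.eigenspace_le_maxGenEigenspace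
  have hfd : FiniteDimensional ℝ (f.eigenspace lam) := Submodule.finiteDimensional_of_le hle
  have hker : ∀ ξ : LinearMap.ker N, ((ξ : E) : V) ∈ f.eigenspace lam := by
    rintro ⟨ξ, hξ⟩
    rw [Module.End.mem_eigenspace_iff, ← sub_eq_zero]
    exact (hNv ξ).symm.trans (congrArg Subtype.val hξ)
  let ι : LinearMap.ker N →ₗ[ℝ] f.eigenspace lam :=
    (E.subtype ∘ₗ (LinearMap.ker N).subtype).codRestrict _ hker
  exact LinearMap.finrank_le_finrank_of_injective (f := ι) fun ξ η h =>
    Subtype.ext (Subtype.ext (congrArg (fun z : f.eigenspace lam => (z : V)) h))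

theorem finiteDimensional_genEigenspace (h_h : 0 ≤ h) (hL : Continuous L) (hC : ∀ t, ‖L t‖ ≤ C)
    (hT : 0 < T) (hLT : ∀ t, L (t + T) = L t) (hlam : lam ≠ 0) (s : ℝ) :
    FiniteDimensional ℝ (genEigenspace L T lam s) := by
  obtain ⟨N, hN⟩ := exists_isCompactOperator_monodromy_pow h_h hL hC hT hLT s
  exact (exists_spectral_projection _ hN hlam).1

/-- The monodromy operator at any time `t` acts on the states at time `t` of the entire solutions as
`M` does on their parameters. -/
theorem hist_mem_genEigenspace (h_h : 0 ≤ h) (hL : Continuous L) (hC : ∀ t, ‖L t‖ ≤ C)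
    (hT : 0 < T) {E : Type*} [AddCommGroup E] [Module ℝ E] (M : Module.End ℝ E)
    (hM : IsNilpotent (M - lam • (1 : Module.End ℝ E))) (X : E →ₗ[ℝ] C(ℝ, Vec n))
    (hX : ∀ ξ, IsEntireSolution L (X ξ))
    (hXT : ∀ ξ t, hist h (X ξ) (t + T) = hist h (X (M ξ)) t) (ξ : E) (t : ℝ) :
    hist h (X ξ) t ∈ genEigenspace L T lam t := by
  have hstep : ∀ ξ, (monodromyEnd L T t - lam • (1 : Module.End ℝ (State h n))) (hist h (X ξ) t) =
      hist h (X ((M - lam • (1 : Module.End ℝ E)) ξ)) t := fun ξ => by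
    have h1 : monodromyEnd L T t (hist h (X ξ) t) = hist h (X (M ξ)) t := by
      rw [← hXT]
      exact ((hX ξ).isLinearSolution t).monodromy_apply h_h hL hC hT
    rw [LinearMap.sub_apply, h1, LinearMap.sub_apply, map_sub, hist_sub, LinearMap.smul_apply,
      LinearMap.smul_apply, map_smul, hist_smul]
    rfl
  have hsteps : ∀ (j : ℕ) ξ,
      ((monodromyEnd L T t - lam • (1 : Module.End ℝ (State h n))) ^ j) (hist h (X ξ) t) =
        hist h (X (((M - lam • (1 : Module.End ℝ E)) ^ j) ξ)) t := by
    intro j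
    induction j with
    | zero => intro ξ; rfl
    | succ j ih =>
      intro ξ
      rw [pow_succ, Module.End.mul_apply, hstep, ih, pow_succ, Module.End.mul_apply]
  obtain ⟨j, hj⟩ := hM
  refine (Module.End.mem_maxGenEigenspace _ _ _).mpr ⟨j, ?_⟩
  rw [hsteps, hj, LinearMap.zero_apply, map_zero]
  rfl

/-- An entire solution with a vanishing state vanishes afterwards, in particular at `s + j T` for
large `j`; there its state is that of the solution with parameter `M ^ j ξ` at time `s`. -/
theorem injective_hist_of_entire (h_h : 0 ≤ h) (hC : ∀ t, ‖L t‖ ≤ C)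
    (hT : 0 < T) {E : Type*} [AddCommGroup E] [Module ℝ E] (M : Module.End ℝ E)
    (hM : Function.Injective M) (X : E →ₗ[ℝ] C(ℝ, Vec n)) (hX : ∀ ξ, IsEntireSolution L (X ξ))
    {s : ℝ} (hs : ∀ ξ, hist h (X ξ) s = 0 → ξ = 0)
    (hXT : ∀ ξ t, hist h (X ξ) (t + T) = hist h (X (M ξ)) t) {ξ : E} {t : ℝ}
    (h0 : hist h (X ξ) t = 0) : ξ = 0 := by
  have hpow : ∀ (j : ℕ) ξ r, hist h (X ξ) (r + j * T) = hist h (X ((M ^ j) ξ)) r := by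
    intro j
    induction j with
    | zero => intro ξ r; simp
    | succ j ih =>
      intro ξ r
      rw [pow_succ, Module.End.mul_apply, ← ih, ← hXT]
      congr 1
      push_cast
      ring
  obtain ⟨j, hj⟩ := exists_nat_ge ((t - s) / T)
  rw [div_le_iff₀ hT] at hj
  have h1 := (hX ξ).isLinearSolution t
  rw [h0] at h1
  have h2 : hist h (X ξ) (s + j * T) = 0 := by
    ext1 θ
    exact h1.eq_zero h_h hC (by linarith [θ.2.1])
  rw [hpow] at h2
  have h3 := hs _ h2
  have hinj : Function.Injective (M ^ j) := by
    rw [Module.End.coe_pow]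
    exact hM.iterate j
  exact hinj (h3.trans (map_zero _).symm)

/-- The algebraic multiplicity does not depend on the base time: entire solutions embed the
generalized eigenspace at one time into that at any other. -/
theorem finrank_genEigenspace_le (h_h : 0 ≤ h) (hL : Continuous L) (hC : ∀ t, ‖L t‖ ≤ C)
    (hT : 0 < T) (hLT : ∀ t, L (t + T) = L t) (hlam : lam ≠ 0) (s t : ℝ) :
    Module.finrank ℝ (genEigenspace L T lam s) ≤ Module.finrank ℝ (genEigenspace L T lam t) := by
  have := finiteDimensional_genEigenspace h_h hL hC hT hLT hlam s
  have := finiteDimensional_genEigenspace h_h hL hC hT hLT hlam t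
  obtain ⟨M, hM, hnil, -⟩ := exists_restrict_of_eq_maxGenEigenspace (monodromyEnd L T s) hlam
    (E := genEigenspace L T lam s) rfl
  obtain ⟨X, hX, hXs, hXT⟩ := exists_entire_extension h_h hL hC hT hLT s M hM
  let Z : genEigenspace L T lam s →ₗ[ℝ] genEigenspace L T lam t :=
    { toFun := fun ξ => ⟨hist h (X ξ) t,
        hist_mem_genEigenspace h_h hL hC hT M.toLinearMap hnil X hX hXT ξ t⟩
      map_add' := fun ξ η => Subtype.ext (by
        change hist h (X (ξ + η)) t = _
        rw [map_add]; rfl)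
      map_smul' := fun c ξ => Subtype.ext (by
        change hist h (X (c • ξ)) t = _
        rw [map_smul]; rfl) }
  refine LinearMap.finrank_le_finrank_of_injective (f := Z) fun ξ η hξη => ?_
  have h1 : hist h (X ξ) t = hist h (X η) t := congrArg Subtype.val hξη
  refine sub_eq_zero.mp (injective_hist_of_entire h_h hC hT M.toLinearMap M.injective X hX
    (fun ζ h0 => Subtype.ext ((hXs ζ).symm.trans h0)) hXT (t := t) ?_)
  rw [map_sub, hist_sub, h1, sub_self]

end Transport

end PeriodicDDE

/-! ### Moving parameters, generators and the Jordan matrix -/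

namespace PeriodicDDE

section Moving

variable {E S : Type*} [NormedAddCommGroup E] [NormedSpace ℝ E] [FiniteDimensional ℝ E]
  [NormedAddCommGroup S] [NormedSpace ℝ S]

/-- A family of linear maps on a finite-dimensional space, expanded along a basis that does not
depend on the member of the family. -/
theorem exists_linearMap_family_eq_sum (Z : ℝ → E →ₗ[ℝ] S) :
    ∃ (d : ℕ) (b : Fin d → E) (p : Fin d → E →L[ℝ] ℝ), ∀ t ξ, Z t ξ = ∑ j, p j ξ • Z t (b j) := by
  let b := Module.finBasis ℝ E
  refine ⟨_, b, fun j => (b.coord j).toContinuousLinearMap, fun t ξ => ?_⟩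
  conv_lhs => rw [← b.sum_repr ξ]
  rw [map_sum]
  exact Finset.sum_congr rfl fun j _ => map_smul _ _ _

theorem contDiff_linearMap_family_apply {Z : ℝ → E →ₗ[ℝ] S} {N : WithTop ℕ∞}
    (hZ : ∀ ξ, ContDiff ℝ N fun t => Z t ξ) {c : ℝ → E} (hc : ContDiff ℝ N c) :
    ContDiff ℝ N fun t => Z t (c t) := by
  obtain ⟨d, b, p, hp⟩ := exists_linearMap_family_eq_sum Z
  rw [show (fun t => Z t (c t)) = fun t => ∑ j, p j (c t) • Z t (b j) from funext fun t => hp t _]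
  exact ContDiff.sum fun j _ => ((p j).contDiff.comp hc).smul (hZ (b j))

theorem hasDerivAt_linearMap_family_apply {Z Z' : ℝ → E →ₗ[ℝ] S} {t : ℝ}
    (hZ : ∀ ξ, HasDerivAt (fun t => Z t ξ) (Z' t ξ) t) {c : ℝ → E} {c' : E}
    (hc : HasDerivAt c c' t) :
    HasDerivAt (fun t => Z t (c t)) (Z' t (c t) + Z t c') t := by
  obtain ⟨d, b, p, hp⟩ := exists_linearMap_family_eq_sum Z
  have hZ' : Z' t (c t) = ∑ j, p j (c t) • Z' t (b j) := by
    refine (hZ (c t)).unique ?_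
    simp only [hp _ (c t)]
    exact HasDerivAt.fun_sum fun j _ => (hZ (b j)).const_smul (p j (c t))
  rw [hZ', hp t c', ← Finset.sum_add_distrib]
  simp only [hp _ (c _)]
  exact HasDerivAt.fun_sum fun j _ => ((p j).hasFDerivAt.comp_hasDerivAt t hc).smul (hZ (b j))

end Moving

section Generators

variable {h : ℝ} {n : ℕ} {L : ℝ → State h n →L[ℝ] Vec n}

theorem onLine_apply (φ : State h n) (θ : Set.Icc (-h) (0 : ℝ)) : onLine φ θ = φ θ :=
  Subtype.val_injective.extend_apply _ _ _

theorem onLine_zero (h_h : 0 ≤ h) (φ : State h n) :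
    onLine φ 0 = φ ⟨0, neg_nonpos.mpr h_h, le_rfl⟩ :=
  onLine_apply φ ⟨0, neg_nonpos.mpr h_h, le_rfl⟩

/-- The embedding `j : X → X^{⊙⋆}` as a bounded linear map. -/
noncomputable def embedCLM (n : ℕ) (h_h : 0 ≤ h) : State h n →L[ℝ] SunStar h n :=
  (ContinuousMap.evalCLM ℝ ⟨0, neg_nonpos.mpr h_h, le_rfl⟩).prod
    (ContinuousMap.toLp ⊤ (delayMeasure h) ℝ)

theorem embedCLM_apply (h_h : 0 ≤ h) (φ : State h n) : embedCLM n h_h φ = embed φ :=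
  Prod.ext (onLine_zero h_h φ).symm rfl

/-- For a function on the line solving the equation at time `t`, the history of the derivative is
the generator applied to the history. -/
theorem generator_hist (h_h : 0 ≤ h) {x x' : C(ℝ, Vec n)}
    (hx : ∀ t, HasDerivAt x (x' t) t) {t : ℝ} (hx' : x' t = L t (hist h x t)) :
    Generator (L t) (hist h x t) (hist h x' t) := by
  refine ⟨fun θ => ?_, ?_⟩
  · have h1 : HasDerivAt (fun r => x (t + r)) (x' (t + θ)) θ := (hx (t + θ)).comp_const_add t θ
    refine h1.hasDerivWithinAt.congr_of_mem (fun r hr => ?_) θ.2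
    exact onLine_apply (hist h x t) ⟨r, hr⟩
  · rw [onLine_zero h_h, hist_apply, ← hx', add_zero]

theorem Generator.sum {ι : Type*} (s : Finset ι) {Lτ : State h n →L[ℝ] Vec n} (h_h : 0 ≤ h)
    {φ ψ : ι → State h n} (H : ∀ i ∈ s, Generator Lτ (φ i) (ψ i)) (c : ι → ℝ) :
    Generator Lτ (∑ i ∈ s, c i • φ i) (∑ i ∈ s, c i • ψ i) := by
  refine ⟨fun θ => ?_, ?_⟩
  · have h1 : HasDerivWithinAt (fun r => ∑ i ∈ s, c i • onLine (φ i) r) (∑ i ∈ s, c i • ψ i θ)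
        (Set.Icc (-h) 0) θ :=
      HasDerivWithinAt.fun_sum fun i hi => ((H i hi).1 θ).const_smul (c i)
    have h2 : (∑ i ∈ s, c i • ψ i) θ = ∑ i ∈ s, c i • ψ i θ := by simp
    rw [h2]
    refine h1.congr_of_mem (fun r hr => ?_) θ.2
    have h3 : ∀ χ : State h n, onLine χ r = χ ⟨r, hr⟩ := fun χ => onLine_apply χ ⟨r, hr⟩
    simp [h3]
  · rw [onLine_zero h_h, map_sum]
    simp only [map_smul]
    rw [ContinuousMap.sum_apply]
    refine Finset.sum_congr rfl fun i hi => ?_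
    rw [← (H i hi).2, onLine_zero h_h]
    rfl

/-- The sun-star generator extends the generator; a `C¹` state is Lipschitz. -/
theorem Generator.sunStarGenerator {Lτ : State h n →L[ℝ] Vec n} {φ ψ : State h n}
    (H : Generator Lτ φ ψ) : SunStarGenerator Lτ (embed φ) (embed ψ) := by
  refine ⟨φ, ⟨‖ψ‖₊, LipschitzWith.of_dist_le_mul fun θ₁ θ₂ => ?_⟩, rfl, H.2, ?_⟩
  · rw [dist_eq_norm, ← onLine_apply, ← onLine_apply, Subtype.dist_eq, Real.dist_eq, coe_nnnorm,
      ← Real.norm_eq_abs]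
    refine Convex.norm_image_sub_le_of_norm_hasDerivWithin_le (s := Set.Icc (-h) 0)
      (f' := onLine ψ) (fun r hr => ?_) (fun r hr => ?_) (convex_Icc _ _) θ₂.2 θ₁.2
    · have h1 := H.1 ⟨r, hr⟩
      rwa [← onLine_apply ψ ⟨r, hr⟩] at h1
    · have h1 := ψ.norm_coe_le_norm ⟨r, hr⟩
      rwa [← onLine_apply ψ ⟨r, hr⟩] at h1
  · filter_upwards [ContinuousMap.coeFn_toLp (p := ⊤) (𝕜 := ℝ) (delayMeasure h) ψ] with θ hθ
    have h1 : (embed ψ).2 θ = ψ θ := hθ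
    rw [h1]
    exact H.1 θ

end Generators

section JordanAlgebra

variable {m : ℕ} {V W : Type*} [AddCommGroup V] [Module ℝ V] [AddCommGroup W] [Module ℝ W]

theorem map_chainPrev {A : V →ₗ[ℝ] W} (δ : Fin m → ℝ) (v : Fin m → V) (i : Fin m) :
    A (chainPrev δ v i) = chainPrev δ (fun j => A (v j)) i := by
  unfold chainPrev
  split_ifs
  · exact map_zero A
  · exact map_smul A _ _

theorem sum_jordanMatrix_smul (σ : ℝ) (δ : Fin m → ℝ) (v : Fin m → V) (j : Fin m) :
    ∑ i, jordanMatrix σ δ i j • v i = σ • v j + chainPrev δ v j := by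
  have h1 : ∀ i, jordanMatrix σ δ i j • v i = (if i = j then σ • v j else 0) +
      if (i : ℕ) + 1 = j then δ j • v i else 0 := fun i => by
    rcases eq_or_ne i j with rfl | hij
    · simp [jordanMatrix]
    · simp [jordanMatrix, hij, ite_smul]
  rw [Finset.sum_congr rfl fun i _ => h1 i, Finset.sum_add_distrib, Finset.sum_ite_eq']
  simp only [Finset.mem_univ, if_true]
  congr 1
  unfold chainPrev
  split_ifs with hj
  · exact Finset.sum_eq_zero fun i _ => if_neg (by omega)
  · rw [Finset.sum_eq_single ⟨(j : ℕ) - 1, by omega⟩]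
    · exact if_pos (by simp; omega)
    · exact fun i _ hi => if_neg fun h => hi (Fin.ext (by simp; omega))
    · simp

/-- The Jordan matrix acts on coordinates as `v j ↦ σ v j + δ j v (j - 1)` acts on the vectors. -/
theorem sum_jordanMatrix_mulVec_smul (σ : ℝ) (δ : Fin m → ℝ) (v : Fin m → V) (ξ : Fin m → ℝ) :
    ∑ i, ((jordanMatrix σ δ).mulVec ξ) i • v i = ∑ j, ξ j • (σ • v j + chainPrev δ v j) := by
  simp only [← sum_jordanMatrix_smul, Matrix.mulVec, dotProduct, Finset.sum_smul, Finset.smul_sum]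
  rw [Finset.sum_comm]
  refine Finset.sum_congr rfl fun i _ => Finset.sum_congr rfl fun j _ => ?_
  rw [smul_smul, mul_comm]

end JordanAlgebra

end PeriodicDDE

/-! ### The Floquet basis and the spectral projector -/

namespace PeriodicDDE

section MovingSolutions

variable {h : ℝ} {n : ℕ} {L : ℝ → State h n →L[ℝ] Vec n} {E : Type*} [NormedAddCommGroup E]
  [NormedSpace ℝ E] [FiniteDimensional ℝ E] {X : E →ₗ[ℝ] C(ℝ, Vec n)}

/-- The state at time `t` of a solution depending linearly on a parameter `ξ`, as a linear map
in `ξ`. -/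
def histLinearMap (X : E →ₗ[ℝ] C(ℝ, Vec n)) (t : ℝ) : E →ₗ[ℝ] State h n where
  toFun ξ := hist h (X ξ) t
  map_add' ξ η := by rw [map_add, hist_add]
  map_smul' c ξ := by rw [map_smul, hist_smul]; rfl

theorem contDiff_hist_entire_apply {k : ℕ} (hL : ContDiff ℝ k L)
    (hX : ∀ ξ, IsEntireSolution L (X ξ)) {c : ℝ → E} (hc : ContDiff ℝ (k + 1) c) :
    ContDiff ℝ (k + 1) fun t => hist h (X (c t)) t := by
  refine contDiff_linearMap_family_apply (Z := histLinearMap X) (fun ξ => ?_) hc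
  have h1 : ContDiff ℝ (k + 1) (X ξ) :=
    contDiff_of_hasDerivAt_hist (G := fun t φ => L t φ) (hX ξ) fun m hm hx =>
      (hL.of_le (by exact_mod_cast hm)).clm_apply hx
  exact_mod_cast contDiff_hist (h := h) (k + 1) (X ξ) (by exact_mod_cast h1)

/-- Along a moving parameter `c`, the derivative of the state is the generator applied to the
state plus the contribution of the derivative of `c`. -/
theorem exists_generator_hasDerivAt_hist (h_h : 0 ≤ h) (hL : Continuous L)
    (hX : ∀ ξ, IsEntireSolution L (X ξ)) {c : ℝ → E} {c' : E} {t : ℝ} (hc : HasDerivAt c c' t) :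
    ∃ ψ, Generator (L t) (hist h (X (c t)) t) ψ ∧
      HasDerivAt (fun r => hist h (X (c r)) r) (ψ + hist h (X c') t) t := by
  have hcont : ∀ x : C(ℝ, Vec n), Continuous fun r => L r (hist h x r) := fun x =>
    hL.clm_apply (continuous_hist x)
  let X' : E →ₗ[ℝ] C(ℝ, Vec n) :=
    { toFun := fun ξ => ⟨fun r => L r (hist h (X ξ) r), hcont (X ξ)⟩
      map_add' := fun ξ η => by
        ext1 r
        exact (congrArg (L r) (by rw [map_add, hist_add])).trans (map_add (L r) _ _)
      map_smul' := fun a ξ => by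
        ext1 r
        have h1 : hist h (X (a • ξ)) r = a • hist h (X ξ) r := by rw [map_smul]; rfl
        exact (congrArg (L r) h1).trans (map_smul (L r) _ _) }
  exact ⟨hist h (X' (c t)) t, generator_hist h_h (x' := X' (c t)) (hX (c t)) rfl,
    hasDerivAt_linearMap_family_apply (Z := histLinearMap X) (Z' := histLinearMap X')
      (fun ξ => hasDerivAt_hist (x' := X' ξ) (hX ξ) t) hc⟩

end MovingSolutions

section Floquet

variable {h : ℝ} {n : ℕ} {L : ℝ → State h n →L[ℝ] Vec n} {C T lam σ : ℝ}

/-- Jordan curves of a parameter space `E` of entire solutions, evaluated along these solutions,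
satisfy the chain equations. -/
theorem exists_antiperiodic_chain (h_h : 0 ≤ h) {k : ℕ} (hL : ContDiff ℝ k L) (hT : 0 < T)
    (hlam : lam < 0) (hσ : Real.exp (σ * T) = |lam|) {E : Type*} [NormedAddCommGroup E]
    [NormedSpace ℝ E] [FiniteDimensional ℝ E] {m : ℕ} (hm : Module.finrank ℝ E = m)
    (M : Module.End ℝ E) (hM : IsNilpotent (M - lam • (1 : Module.End ℝ E)))
    (X : E →ₗ[ℝ] C(ℝ, Vec n)) (hX : ∀ ξ, IsEntireSolution L (X ξ))
    (hXT : ∀ ξ t, hist h (X ξ) (t + T) = hist h (X (M ξ)) t)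
    (hinj : ∀ t ξ, hist h (X ξ) t = 0 → ξ = 0) :
    ∃ (δ : Fin m → ℝ) (φ : Fin m → ℝ → State h n), (∀ i, δ i = 0 ∨ δ i = 1) ∧
      (Module.finrank ℝ (LinearMap.ker (M - lam • (1 : Module.End ℝ E))) ≤ 1 →
        ∀ i : Fin m, (i : ℕ) ≠ 0 → δ i = 1) ∧
      (∀ i, ContDiff ℝ (k + 1) (φ i)) ∧
      (∀ i τ, φ i (τ + T) = -φ i τ) ∧
      (∀ τ, LinearIndependent ℝ fun i => φ i τ) ∧
      (∀ i τ, ∃ ξ, φ i τ = hist h (X ξ) τ) ∧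
      ∀ i τ, ∃ ψ, Generator (L τ) (φ i τ) ψ ∧
        HasDerivAt (φ i) (ψ - (σ • φ i τ + chainPrev δ (fun j => φ j τ) i)) τ := by
  obtain ⟨δ, c, hδ, hgeom, hc, hc', hcT, hli⟩ :=
    exists_antiperiodic_jordan_curves M hlam hT hσ hM hm
  have hneg : ∀ ξ t, hist h (X (-ξ)) t = -hist h (X ξ) t := fun ξ t =>
    map_neg (histLinearMap X t) ξ
  refine ⟨δ, fun i t => hist h (X (c i t)) t, hδ, hgeom,
    fun i => contDiff_hist_entire_apply hL hX ((hc i).of_le le_top), fun i τ => ?_, fun τ => ?_,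
    fun i τ => ⟨c i τ, rfl⟩, fun i τ => ?_⟩
  · dsimp only
    rw [hXT, hcT, hneg]
  · exact (hli τ).map' (histLinearMap X τ) (LinearMap.ker_eq_bot'.mpr (hinj τ))
  · obtain ⟨ψ, hψ, hd⟩ := exists_generator_hasDerivAt_hist h_h hL.continuous hX (hc' i τ)
    refine ⟨ψ, hψ, ?_⟩
    have h1 : hist h (X (σ • c i τ + chainPrev δ (fun j => c j τ) i)) τ =
        σ • hist h (X (c i τ)) τ + chainPrev δ (fun j => hist h (X (c j τ)) τ) i := by
      rw [map_add, hist_add, map_smul, hist_smul]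
      exact congrArg _ (map_chainPrev (A := histLinearMap X τ) δ (fun j => c j τ) i)
    rwa [hneg, h1, ← sub_eq_add_neg] at hd

/-- The Floquet basis of the generalized eigenspaces. The parameter space of entire solutions is the
generalized eigenspace at time `s`; at each `τ` the states of these solutions fill the generalized
eigenspace at `τ`, since the dimensions agree. -/
theorem exists_floquet_chain (h_h : 0 ≤ h) {k : ℕ} (hL : ContDiff ℝ k L) (hC : ∀ t, ‖L t‖ ≤ C)
    (hT : 0 < T) (hLT : ∀ t, L (t + T) = L t) (hlam : lam < 0) (hσ : Real.exp (σ * T) = |lam|)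
    (s : ℝ) :
    ∃ (δ : Fin (algMult L T lam s) → ℝ) (φ : Fin (algMult L T lam s) → ℝ → State h n),
      (∀ i, δ i = 0 ∨ δ i = 1) ∧
      (geomMult L T lam s = 1 → ∀ i : Fin (algMult L T lam s), (i : ℕ) ≠ 0 → δ i = 1) ∧
      (∀ i, ContDiff ℝ (k + 1) (φ i)) ∧
      (∀ i τ, φ i (τ + T) = -φ i τ) ∧
      (∀ τ, LinearIndependent ℝ (fun i => φ i τ) ∧
        Submodule.span ℝ (Set.range fun i => φ i τ) = genEigenspace L T lam τ) ∧
      ∀ i τ, ∃ ψ, Generator (L τ) (φ i τ) ψ ∧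
        HasDerivAt (φ i) (ψ - (σ • φ i τ + chainPrev δ (fun j => φ j τ) i)) τ := by
  have hLc := hL.continuous
  have hfd := finiteDimensional_genEigenspace h_h hLc hC hT hLT hlam.ne
  have := hfd s
  obtain ⟨M, hM, hnil, hker⟩ := exists_restrict_of_eq_maxGenEigenspace (monodromyEnd L T s)
    hlam.ne (E := genEigenspace L T lam s) rfl
  obtain ⟨X, hX, hXs, hXT⟩ := exists_entire_extension h_h hLc hC hT hLT s M hM
  obtain ⟨δ, φ, hδ, hgeom, hφ, hanti, hind, hval, hchain⟩ :=
    exists_antiperiodic_chain h_h hL hT hlam hσ (E := genEigenspace L T lam s)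
      (m := algMult L T lam s) rfl M.toLinearMap hnil X hX hXT fun τ ξ h0 =>
        injective_hist_of_entire h_h hC hT M.toLinearMap M.injective X hX
          (fun ζ h0 => Subtype.ext ((hXs ζ).symm.trans h0)) hXT h0
  refine ⟨δ, φ, hδ, fun hg => hgeom (hker.trans_eq hg), hφ, hanti, fun τ => ⟨hind τ, ?_⟩, hchain⟩
  have := hfd τ
  refine Submodule.eq_of_le_of_finrank_le (Submodule.span_le.mpr ?_) ?_
  · rintro _ ⟨i, rfl⟩
    obtain ⟨ξ, hξ⟩ := hval i τ
    dsimp only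
    rw [hξ]
    exact hist_mem_genEigenspace h_h hLc hC hT M.toLinearMap hnil X hX hXT ξ τ
  · rw [finrank_span_eq_card (hind τ), Fintype.card_fin]
    exact finrank_genEigenspace_le h_h hLc hC hT hLT hlam.ne τ s

theorem exists_periodic_projection (h_h : 0 ≤ h) (hL : Continuous L) (hC : ∀ t, ‖L t‖ ≤ C)
    (hT : 0 < T) (hLT : ∀ t, L (t + T) = L t) (hlam : lam ≠ 0) :
    ∃ P : ℝ → State h n →L[ℝ] State h n,
      (∀ τ, P τ ∘L P τ = P τ) ∧
      (∀ τ, LinearMap.range (P τ : State h n →ₗ[ℝ] State h n) = genEigenspace L T lam τ) ∧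
      (∀ τ, P τ ∘L monodromy L T τ = monodromy L T τ ∘L P τ) ∧
      (∀ τ, P (τ + T) = P τ) := by
  have hP : ∀ A : Set.range (monodromy L T), ∃ P : State h n →L[ℝ] State h n, P ∘L P = P ∧
      LinearMap.range (P : State h n →ₗ[ℝ] State h n) =
        Module.End.maxGenEigenspace (A.1 : Module.End ℝ (State h n)) lam ∧
      P ∘L A.1 = A.1 ∘L P := by
    rintro ⟨_, τ, rfl⟩
    obtain ⟨N, hN⟩ := exists_isCompactOperator_monodromy_pow h_h hL hC hT hLT τ
    exact (exists_spectral_projection _ hN hlam).2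
  -- the choice depends on the monodromy operator only, which is periodic
  choose P h1 h2 h3 using hP
  refine ⟨fun τ => P ⟨monodromy L T τ, τ, rfl⟩, fun τ => h1 _, fun τ => h2 _, fun τ => h3 _,
    fun τ => congrArg P (Subtype.ext (monodromy_add_period h_h hL hC hT hLT τ))⟩

/-- The chain equations, in matrix form for the Floquet operator. -/
theorem hasDerivAt_floquetOperator {m : ℕ} (h_h : 0 ≤ h) {δ : Fin m → ℝ}
    {φ : Fin m → ℝ → State h n} {τ : ℝ}
    (H : ∀ i, ∃ ψ, Generator (L τ) (φ i τ) ψ ∧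
      HasDerivAt (φ i) (ψ - (σ • φ i τ + chainPrev δ (fun j => φ j τ) i)) τ) (ξ : Fin m → ℝ) :
    ∃ ψ, Generator (L τ) (floquetOperator φ τ ξ) ψ ∧
      HasDerivAt (fun t => floquetOperator φ t ξ)
        (ψ - floquetOperator φ τ ((jordanMatrix σ δ).mulVec ξ)) τ := by
  choose ψ hψ hd using H
  simp only [floquetOperator, Fintype.linearCombination_apply, sum_jordanMatrix_mulVec_smul]
  refine ⟨∑ i, ξ i • ψ i, Generator.sum _ h_h (fun i _ => hψ i) ξ, ?_⟩
  have h1 := HasDerivAt.fun_sum (u := Finset.univ) fun i _ => (hd i).const_smul (ξ i)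
  simp only [smul_sub, Finset.sum_sub_distrib] at h1
  exact h1

end Floquet

end PeriodicDDE

theorem mainTheorem2 {n k : ℕ} (h_k : 1 ≤ k) {h : ℝ} (h_h : 0 < h)
    (F : PeriodicDDE.State h n → PeriodicDDE.Vec n) (h_F : ContDiff ℝ (k + 1) F)
    (γ : C(ℝ, PeriodicDDE.Vec n)) {T : ℝ} (h_γ : PeriodicDDE.IsPeriodicSolution F γ T)
    (L : ℝ → PeriodicDDE.State h n →L[ℝ] PeriodicDDE.Vec n)
    (h_L : L = PeriodicDDE.linearization F γ)
    (s lam σ : ℝ) (h_lam : lam < 0)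
    (h_mult : PeriodicDDE.IsFloquetMultiplier L T s (lam : ℂ))
    (h_σ : Real.exp (σ * T) = |lam|) :
    (∃ (δ : Fin (PeriodicDDE.algMult L T lam s) → ℝ)
      (φ : Fin (PeriodicDDE.algMult L T lam s) → ℝ → PeriodicDDE.State h n),
      -- Jordan structure: a single chain when the geometric multiplicity is one
      (∀ i, δ i = 0 ∨ δ i = 1) ∧
      (PeriodicDDE.geomMult L T lam s = 1 → ∀ i : Fin (PeriodicDDE.algMult L T lam s), (i : ℕ) ≠ 0 → δ i = 1) ∧
      -- smoothness, periodicity, antiperiodicity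
      (∀ i, ContDiff ℝ (k + 1) (φ i)) ∧
      (∀ i, Function.Periodic (φ i) (2 * T)) ∧
      (∀ i τ, φ i (τ + T) = -φ i τ) ∧
      -- ordered basis of the (generalized) eigenspace at every time
      (∀ τ, LinearIndependent ℝ (fun i => φ i τ) ∧
        Submodule.span ℝ (Set.range fun i => φ i τ) =
          PeriodicDDE.genEigenspace L T lam τ) ∧
      -- chain equations in the sun-star space
      (∀ i τ, ∃ D y : PeriodicDDE.SunStar h n,
        HasDerivAt (fun t => PeriodicDDE.embed (φ i t)) D τ ∧
        PeriodicDDE.SunStarGenerator (L τ) (PeriodicDDE.embed (φ i τ)) y ∧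
        D - y + σ • PeriodicDDE.embed (φ i τ) =
          -PeriodicDDE.embed (PeriodicDDE.chainPrev δ (fun i => φ i τ) i)) ∧
      -- chain equations in the state space
      (∀ i τ, ∃ D ψ : PeriodicDDE.State h n,
        HasDerivAt (φ i) D τ ∧
        PeriodicDDE.Generator (L τ) (φ i τ) ψ ∧
        D - ψ + σ • φ i τ = -PeriodicDDE.chainPrev δ (fun i => φ i τ) i) ∧
      -- the Floquet operator
      (∀ τ, PeriodicDDE.floquetOperator φ (τ + T) = -PeriodicDDE.floquetOperator φ τ) ∧
      (∀ ξ τ, ∃ D y : PeriodicDDE.SunStar h n,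
        HasDerivAt (fun t => PeriodicDDE.embed (PeriodicDDE.floquetOperator φ t ξ)) D τ ∧
        PeriodicDDE.SunStarGenerator (L τ)
          (PeriodicDDE.embed (PeriodicDDE.floquetOperator φ τ ξ)) y ∧
        -D + y = PeriodicDDE.embed
          (PeriodicDDE.floquetOperator φ τ ((PeriodicDDE.jordanMatrix σ δ).mulVec ξ)))) ∧
    -- the real periodic spectral projector
    (∃ P : ℝ → PeriodicDDE.State h n →L[ℝ] PeriodicDDE.State h n,
      (∀ τ, P τ ∘L P τ = P τ) ∧
      (∀ τ, LinearMap.range (P τ : PeriodicDDE.State h n →ₗ[ℝ] PeriodicDDE.State h n) =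
        PeriodicDDE.genEigenspace L T lam τ) ∧
      (∀ τ, P τ ∘L PeriodicDDE.monodromy L T τ = PeriodicDDE.monodromy L T τ ∘L P τ) ∧
      (∀ τ, P (τ + T) = P τ)) := by
  subst h_L
  have hT := h_γ.period_pos
  have hL := PeriodicDDE.contDiff_linearization h_F h_γ
  have hLT := PeriodicDDE.linearization_add_period h_γ
  obtain ⟨C, hC⟩ := PeriodicDDE.exists_norm_le_of_periodic hL.continuous hT hLT
  obtain ⟨δ, φ, hδ, hgeom, hsmooth, hanti, hbasis, hchain⟩ :=
    PeriodicDDE.exists_floquet_chain h_h.le hL hC hT hLT h_lam h_σ s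
  -- equations in the state space carry over to the sun-star space through the bounded map `embed`
  have hsub : ∀ φ ψ : PeriodicDDE.State h n,
      PeriodicDDE.embed (φ - ψ) = PeriodicDDE.embed φ - PeriodicDDE.embed ψ := fun φ ψ => by
    simp only [← PeriodicDDE.embedCLM_apply h_h.le, map_sub]
  have hd_embed : ∀ {f : ℝ → PeriodicDDE.State h n} {f'} {τ}, HasDerivAt f f' τ →
      HasDerivAt (fun t => PeriodicDDE.embed (f t)) (PeriodicDDE.embed f') τ := fun hf => by
    simp only [← PeriodicDDE.embedCLM_apply h_h.le]
    exact (PeriodicDDE.embedCLM n h_h.le).hasFDerivAt.comp_hasDerivAt _ hf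
  refine ⟨⟨δ, φ, hδ, hgeom, hsmooth, fun i τ => ?_, hanti, hbasis, fun i τ => ?_, fun i τ => ?_,
    fun τ => ?_, fun ξ τ => ?_⟩,
    PeriodicDDE.exists_periodic_projection h_h.le hL.continuous hC hT hLT h_lam.ne⟩
  · rw [two_mul, ← add_assoc, hanti, hanti, neg_neg]
  · obtain ⟨ψ, hψ, hd⟩ := hchain i τ
    refine ⟨_, _, hd_embed hd, hψ.sunStarGenerator, ?_⟩
    simp only [← PeriodicDDE.embedCLM_apply h_h.le, map_sub, map_add, map_smul]
    abel
  · obtain ⟨ψ, hψ, hd⟩ := hchain i τ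
    exact ⟨_, ψ, hd, hψ, by abel⟩
  · refine LinearMap.ext fun ξ => ?_
    simp only [PeriodicDDE.floquetOperator, Fintype.linearCombination_apply, hanti, smul_neg,
      Finset.sum_neg_distrib, LinearMap.neg_apply]
  · obtain ⟨ψ, hψ, hd⟩ := PeriodicDDE.hasDerivAt_floquetOperator h_h.le (fun i => hchain i τ) ξ
    refine ⟨_, _, hd_embed hd, hψ.sunStarGenerator, ?_⟩
    rw [hsub]
    abel
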